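/- Let $n\ge 1$ and $m$ be integers (with $m\ge 1$; the case $m=0$ is also allowed and trivial), let $M$ be a smooth manifold of dimension $(n+1)m+1$, and let $\mathcal D\subset TM$ be a smooth distribution of rank $m+1$, that is, a field of tangent subspaces locally spanned by $m+1$ pointwise linearly independent smooth vector fields. Let the derived flag and the Lie flag of $\mathcal D$ be the sequences of modules of (locally defined) smooth vector fields given by $$\mathcal D^{(0)}=\mathcal D,\quad \mathcal D^{(i+1)}=\mathcal D^{(i)}+[\mathcal D^{(i)},\mathcal D^{(i)}],\qquad \mathcal D_0=\mathcal D,\quad \mathcal D_{i+1}=\mathcal D_i+[\mathcal D_0,\mathcal D_i],$$ and let $\mathcal D^{(i)}(p),\mathcal D_i(p)\subset T_pM$ be the subspaces formed by the values at $p$ of their elements. Let $J^n(\mathbb R,\mathbb R^m)\cong\mathbb R^{(n+1)m+1}$ have coordinates $x_0^0$ and $x_j^i$ ($0\le i\le n$, $1\le j\le m$); its canonical contact system is the distribution spanned by the vector fields $$\frac{\partial}{\partial x_1^n},\ \dots,\ \frac{\partial}{\partial x_m^n},\qquad \sum_{i=0}^{n-1}\sum_{j=1}^m x_j^{i+1}\frac{\partial}{\partial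 x_j^i}+\frac{\partial}{\partial x_0^0}.$$ Then the following are equivalent. (A) Every point $p\in M$ has an open neighbourhood $U$ with a smooth diffeomorphism $\varphi$ of $U$ onto an open subset of $J^n(\mathbb R,\mathbb R^m)$ such that, for every $q\in U$, the differential $d\varphi_q$ maps $\mathcal D(q)$ onto the canonical contact system at $\varphi(q)$. (B) For every $0\le i\le n$ the following two conditions hold: (i) $\dim\mathcal D^{(i)}(p)=(i+1)m+1$ for all $p\in M$, and locally $\mathcal D^{(i)}$ contains an involutive subdistribution of constant corank one: every point of $M$ has an open neighbourhood $U$ carrying a smooth distribution $\mathcal L_i$ of rank $(i+1)m$ with $\mathcal L_i^{(1)}=\mathcal L_i^{(0)}$ and $\mathcal L_i(q)\subset\mathcal D^{(i)}(q)$ for all $q\in U$; (ii) $\dim\mathcal D_i(p)=(i+1)m+1$ for all $p\in M$. -/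

import Mathlib

open scoped Manifold ContDiff

/-- A (not necessarily continuous) vector field on `M`. Only its values on the open set under
consideration matter below. -/
abbrev RawVectorField {E H : Type*} [NormedAddCommGroup E] [NormedSpace ℝ E]
    [TopologicalSpace H] (I : ModelWithCorners ℝ E H)
    (M : Type*) [TopologicalSpace M] [ChartedSpace H M] :=
  (p : M) → TangentSpace I p

/-- A field of tangent subspaces on `M` (no smoothness, no constancy of the dimension). -/
abbrev PlaneField {E H : Type*} [NormedAddCommGroup E] [NormedSpace ℝ E]
    [TopologicalSpace H] (I : ModelWithCorners ℝ E H)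
    (M : Type*) [TopologicalSpace M] [ChartedSpace H M] :=
  (p : M) → Submodule ℝ (TangentSpace I p)

namespace PlaneField

section Defs

variable {E H : Type*} [NormedAddCommGroup E] [NormedSpace ℝ E] [TopologicalSpace H]
  {I : ModelWithCorners ℝ E H} {M : Type*} [TopologicalSpace M] [ChartedSpace H M]
  [IsManifold I ∞ M]

/-- `X` is a smooth vector field on `U`. -/
def IsSmoothOn (X : RawVectorField I M) (U : Set M) : Prop :=
  ContMDiffOn I I.tangent ∞ (fun p => (⟨p, X p⟩ : TangentBundle I M)) U

/-- `D` is a smooth distribution of rank `k` on the open set `U`: around every point of `U` it is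
spanned by `k` smooth, pointwise linearly independent vector fields. -/
def IsDistributionOn (D : PlaneField I M) (k : ℕ) (U : TopologicalSpace.Opens M) : Prop :=
  ∀ p ∈ U, ∃ V : TopologicalSpace.Opens M, p ∈ V ∧ V ≤ U ∧
    ∃ f : Fin k → RawVectorField I M,
      (∀ j, IsSmoothOn (f j) V) ∧
      ∀ q ∈ V, LinearIndependent ℝ (fun j => f j q) ∧
        D q = Submodule.span ℝ (Set.range fun j => f j q)

/-- `D` is a smooth distribution of rank `k` on the whole manifold. -/
def IsDistribution (D : PlaneField I M) (k : ℕ) : Prop :=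
  D.IsDistributionOn k ⊤

/-- The smooth vector fields on `U` that are tangent to `D`. -/
def sectionsOn (D : PlaneField I M) (U : TopologicalSpace.Opens M) : Set (RawVectorField I M) :=
  {X | IsSmoothOn X U ∧ ∀ p ∈ U, X p ∈ D p}

/-- The `C^∞(U)`-module of vector fields on `U` generated by a set of vector fields. -/
def moduleSpan (U : TopologicalSpace.Opens M) (S : Set (RawVectorField I M)) :
    Set (RawVectorField I M) :=
  {X | ∃ (k : ℕ) (a : Fin k → M → ℝ) (Y : Fin k → RawVectorField I M),
    (∀ j, ContMDiffOn I 𝓘(ℝ, ℝ) ∞ (a j) U) ∧ (∀ j, Y j ∈ S) ∧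
    ∀ p ∈ U, X p = ∑ j, a j p • Y j p}

/-- All Lie brackets `[X, Y]` with `X ∈ A` and `Y ∈ B`. -/
def brackets (A B : Set (RawVectorField I M)) : Set (RawVectorField I M) :=
  {Z | ∃ X ∈ A, ∃ Y ∈ B, Z = VectorField.mlieBracket I X Y}

/-- The derived flag of `D` over the open set `U`, as a sequence of modules of vector fields:
`D^(0) = D` and `D^(i+1) = D^(i) + [D^(i), D^(i)]`. -/
noncomputable def derivedModule (D : PlaneField I M) (U : TopologicalSpace.Opens M) :
    ℕ → Set (RawVectorField I M)
  | 0 => D.sectionsOn U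
  | i + 1 => moduleSpan U
      (derivedModule D U i ∪ brackets (derivedModule D U i) (derivedModule D U i))

/-- The Lie flag of `D` over the open set `U`, as a sequence of modules of vector fields:
`D_0 = D` and `D_{i+1} = D_i + [D_0, D_i]`. -/
noncomputable def lieModule (D : PlaneField I M) (U : TopologicalSpace.Opens M) :
    ℕ → Set (RawVectorField I M)
  | 0 => D.sectionsOn U
  | i + 1 => moduleSpan U
      (lieModule D U i ∪ brackets (D.sectionsOn U) (lieModule D U i))

/-- The subspace `D^(i)(p)` of the tangent space at `p`: the values at `p` of the elements of
`D^(i)` defined on an open neighbourhood of `p`. -/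
noncomputable def derivedFlag (D : PlaneField I M) (i : ℕ) : PlaneField I M := fun p =>
  Submodule.span ℝ
    {v | ∃ U : TopologicalSpace.Opens M, p ∈ U ∧ ∃ X ∈ D.derivedModule U i, X p = v}

/-- The subspace `D_i(p)` of the tangent space at `p`: the values at `p` of the elements of
`D_i` defined on an open neighbourhood of `p`. -/
noncomputable def lieFlag (D : PlaneField I M) (i : ℕ) : PlaneField I M := fun p =>
  Submodule.span ℝ
    {v | ∃ U : TopologicalSpace.Opens M, p ∈ U ∧ ∃ X ∈ D.lieModule U i, X p = v}

/-- The plane field has constant rank `k`. -/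
def HasConstantRank (D : PlaneField I M) (k : ℕ) : Prop :=
  ∀ p, Module.finrank ℝ (D p) = k

/-- `D` is involutive on `U`: `D^(1) = D^(0)`, as modules of vector fields over every open
subset of `U`. -/
def IsInvolutiveOn (D : PlaneField I M) (U : TopologicalSpace.Opens M) : Prop :=
  ∀ V : TopologicalSpace.Opens M, V ≤ U → D.derivedModule V 1 = D.derivedModule V 0

/-- Around every point, `F` contains an involutive subdistribution `L` of constant corank one
in `F`. -/
def ContainsInvolutiveCorankOne (F : PlaneField I M) : Prop :=
  ∀ p, ∃ U : TopologicalSpace.Opens M, p ∈ U ∧ ∃ (L : PlaneField I M) (k : ℕ),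
    L.IsDistributionOn k U ∧ L.IsInvolutiveOn U ∧
    ∀ q ∈ U, L q ≤ F q ∧ Module.finrank ℝ (F q) = k + 1

/-- `D` is equivalent, in a neighbourhood of `p`, to `D'`: some smooth diffeomorphism of an open
neighbourhood of `p` onto an open subset of `M'` carries `D` to `D'`. -/
def LocallyEquivalentAt {E' H' : Type*} [NormedAddCommGroup E'] [NormedSpace ℝ E']
    [TopologicalSpace H'] {I' : ModelWithCorners ℝ E' H'}
    {M' : Type*} [TopologicalSpace M'] [ChartedSpace H' M']
    (D : PlaneField I M) (D' : PlaneField I' M') (p : M) : Prop :=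
  ∃ φ : OpenPartialHomeomorph M M', p ∈ φ.source ∧
    ContMDiffOn I I' ∞ φ φ.source ∧ ContMDiffOn I' I ∞ φ.symm φ.target ∧
    ∀ q ∈ φ.source, (D q).map (mfderiv I I' φ q).toLinearMap = D' (φ q)

end Defs

end PlaneField

/-- The jet space `J^n(ℝ, ℝ^m)` in its canonical coordinates: `z.1` is the independent variable
`x_0^0`, and `z.2 i j` is the coordinate `x_j^i`, the `i`-th derivative of the `j`-th component
(the components are numbered from `0`). -/
abbrev JetSpace (n m : ℕ) : Type := ℝ × (Fin (n + 1) → Fin m → ℝ)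

namespace JetSpace

/-- The vector field `∂ / ∂ x_j^n`. -/
def verticalField (n m : ℕ) (j : Fin m) : RawVectorField 𝓘(ℝ, JetSpace n m) (JetSpace n m) :=
  fun _ => ((0, Pi.single (Fin.last n) (Pi.single j 1)) : JetSpace n m)

/-- The vector field `∑_{i < n} ∑_j x_j^{i+1} ∂ / ∂ x_j^i + ∂ / ∂ x_0^0`. -/
def totalDerivative (n m : ℕ) : RawVectorField 𝓘(ℝ, JetSpace n m) (JetSpace n m) :=
  fun z => ((1, fun i j => if h : (i : ℕ) + 1 < n + 1 then z.2 ⟨i + 1, h⟩ j else 0) :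
    JetSpace n m)

/-- The canonical contact system on `J^n(ℝ, ℝ^m)`. -/
noncomputable def contactSystem (n m : ℕ) : PlaneField 𝓘(ℝ, JetSpace n m) (JetSpace n m) :=
  fun z => Submodule.span ℝ
    (Set.range (fun j => verticalField n m j z) ∪ {totalDerivative n m z})

end JetSpace

/-! Necessity. Pullback by a diffeomorphism commutes with brackets, so both flags, their ranks and
the involutive subdistributions are transported, and it is enough to treat the model. Put ω_j^l =
dx_j^l - x_j^{l+1} dx_0^0. Bracketing ∂/∂x_j^{l+1} with the total derivative produces ∂/∂x_j^l up to
sign, while dω_j^l = dx_0^0 ∧ ω_j^{l+1} for l + 1 < n. The first fact bounds the Lie flag from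
below, the second bounds the derived flag from above, and both D_i and D^(i) equal the common kernel
of the ω_j^l with l < n - i. The span of the ∂/∂x_j^l with l ≥ n - i is involutive of corank one in
it.

Sufficiency. Let ν = n - 1. By Frobenius the involutive L ⊂ D^(ν) has m + 1 independent first
integrals; since L has corank one in D^(ν), they can be chosen as z, x_1, …, x_m so that D^(ν) is
annihilated by m independent forms dx_j - y_j dz (`exists_isContactCoframe`). The equality D_n = TM
is then used to arrange that z is not constant along D at the base point
(`IsContactCoframe.exists_transverse`). So D has a field X with dz(X) = 1, and the remaining
coordinates are the iterated derivatives g_l = X^l x.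

One bracket formula, `contactForm_lieBracket`, drives the rest. It shows that ω_l = dg_l - g_{l+1}
dz annihilates D^(k) for l + k ≤ ν (`contactForm_eq_zero`), and that ω_l maps D^(k) onto ℝ^m at the
base point for l + k = ν + 1 (`map_flagAt`). With the ranks this forces dz and the dg_l, l ≤ n, to
be independent. In the resulting coordinates D lies in the contact system, and equality follows from
equality of ranks.

Frobenius' theorem is itself proved by applying the implicit function theorem in the Banach space of
continuous curves. -/

open Filter Topology

/-! ### Superposition and integration operators on spaces of continuous functions. -/

namespace ContinuousMap

variable {K E F : Type*} [TopologicalSpace K] [CompactSpace K]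
  [NormedAddCommGroup E] [NormedSpace ℝ E] [NormedAddCommGroup F] [NormedSpace ℝ F]

/-- Pointwise application of a continuous family of operators to a continuous family of
vectors, as a bounded bilinear operation. -/
noncomputable def applyL : C(K, E →L[ℝ] F) →L[ℝ] C(K, E) →L[ℝ] C(K, F) :=
  LinearMap.mkContinuous₂
    (LinearMap.mk₂ ℝ (fun (A : C(K, E →L[ℝ] F)) (u : C(K, E)) =>
        (⟨fun s => A s (u s), A.continuous.clm_apply u.continuous⟩ : C(K, F)))
      (fun _ _ _ => by ext; simp) (fun _ _ _ => by ext; simp)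
      (fun _ _ _ => by ext; simp) (fun _ _ _ => by ext; simp)) 1
    (fun A u => by
      rw [one_mul]
      refine (ContinuousMap.norm_le _ (by positivity)).2 fun s => ?_
      exact (A s).le_of_opNorm_le_of_le (A.norm_coe_le_norm s) (u.norm_coe_le_norm s))

@[simp] lemma applyL_apply (A : C(K, E →L[ℝ] F)) (u : C(K, E)) (s : K) :
    applyL A u s = A s (u s) := rfl

/-- Constant functions, as a continuous linear map. -/
noncomputable def constL (K : Type*) [TopologicalSpace K] [CompactSpace K] (E : Type*)
    [NormedAddCommGroup E] [NormedSpace ℝ E] : E →L[ℝ] C(K, E) :=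
  LinearMap.mkContinuous
    { toFun := fun x => ContinuousMap.const K x
      map_add' := fun _ _ => by ext; simp
      map_smul' := fun _ _ => by ext; simp } 1
    (fun x => by
      rw [one_mul]
      exact (ContinuousMap.norm_le _ (by positivity)).2 fun s => le_rfl)

@[simp] lemma constL_apply (x : E) (s : K) : constL K E x s = x := rfl

/-- Superposition with a `C^1` map is differentiable on spaces of continuous functions. -/
lemma hasFDerivAt_comp_left {g : E → F} (hg : Differentiable ℝ g)
    (hg' : Continuous (fderiv ℝ g)) (u : C(K, E)) :
    HasFDerivAt (fun u : C(K, E) => (⟨g, hg.continuous⟩ : C(E, F)).comp u)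
      (applyL ((⟨fderiv ℝ g, hg'⟩ : C(E, E →L[ℝ] F)).comp u)) u := by
  rw [hasFDerivAt_iff_isLittleO_nhds_zero, Asymptotics.isLittleO_iff]
  intro ε hε
  let N : C(K, E) → C(K, E →L[ℝ] F) :=
    fun u => (⟨fderiv ℝ g, hg'⟩ : C(E, E →L[ℝ] F)).comp u
  have hc : ContinuousAt N u := (ContinuousMap.continuous_postcomp _).continuousAt
  obtain ⟨δ, hδ, hd⟩ := (Metric.continuousAt_iff (f := N) (a := u)).1 hc ε hε
  filter_upwards [Metric.ball_mem_nhds (0 : C(K, E)) hδ] with h hh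
  rw [mem_ball_zero_iff] at hh
  refine (ContinuousMap.norm_le _ (by positivity)).2 fun s => ?_
  have key := Convex.norm_image_sub_le_of_norm_fderiv_le' (𝕜 := ℝ) (f := g) (C := ε)
    (s := Metric.ball (u s) δ) (x := u s) (y := u s + h s) (φ := fderiv ℝ g (u s))
    (fun x _ => hg x) (fun x hx => ?_) (convex_ball _ _) (Metric.mem_ball_self hδ)
    (by simpa using (h.norm_coe_le_norm s).trans_lt hh)
  · simp only [add_sub_cancel_left] at key
    exact key.trans (by gcongr; exact h.norm_coe_le_norm s)
  -- Shifting the whole function u by the constant x - u s moves it by less than δ in the sup norm,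
  -- so continuity of superposition with `fderiv ℝ g` at u gives a bound that is uniform in s.
  · have h1 : dist (u + constL K E (x - u s)) u < δ := by
      rw [dist_eq_norm, add_sub_cancel_left]
      rw [Metric.mem_ball, dist_eq_norm] at hx
      exact (ContinuousMap.norm_lt_iff _ hδ).2 fun _ => hx
    have h2 := hd h1
    have h3 := (ContinuousMap.dist_lt_iff hε).1 h2 s
    rw [dist_eq_norm] at h3
    simpa [N] using h3.le

/-- The derivative of superposition with g is pointwise application of superposition with `fderiv ℝ
g`, so smoothness follows by induction on the order. The induction replaces F by the operators from
E to F, which is why F varies and shares a universe with E. -/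
lemma contDiff_comp_left_nat.{u} (n : ℕ) {E F : Type u} [NormedAddCommGroup E] [NormedSpace ℝ E]
    [NormedAddCommGroup F] [NormedSpace ℝ F] {g : E → F} (hg : ContDiff ℝ ∞ g) :
    ContDiff ℝ n (fun u : C(K, E) => (⟨g, hg.continuous⟩ : C(E, F)).comp u) := by
  induction n generalizing F with
  | zero => exact contDiff_zero.2 (ContinuousMap.continuous_postcomp _)
  | succ n ih =>
    have hg' : ContDiff ℝ ∞ (fderiv ℝ g) := hg.fderiv_right (by simp)
    have := contDiff_succ_iff_hasFDerivAt (𝕜 := ℝ) (n := n)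
      (f := fun u : C(K, E) => (⟨g, hg.continuous⟩ : C(E, F)).comp u)
    push_cast
    refine this.2 ⟨_, ?_, fun u => hasFDerivAt_comp_left (hg.differentiable (by simp))
      hg'.continuous u⟩
    exact applyL.contDiff.comp (ih hg')

/-- Superposition with a smooth map is smooth on spaces of continuous functions. -/
lemma contDiff_comp_left.{u} {E F : Type u} [NormedAddCommGroup E] [NormedSpace ℝ E]
    [NormedAddCommGroup F] [NormedSpace ℝ F] {g : E → F} (hg : ContDiff ℝ ∞ g) :
    ContDiff ℝ ∞ (fun u : C(K, E) => (⟨g, hg.continuous⟩ : C(E, F)).comp u) :=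
  contDiff_infty.2 fun n => contDiff_comp_left_nat n hg

/-- The primitive vanishing at `0` of a continuous function on the unit interval. -/
noncomputable def primitiveL (E : Type*) [NormedAddCommGroup E] [NormedSpace ℝ E] :
    C(unitInterval, E) →L[ℝ] C(unitInterval, E) :=
  LinearMap.mkContinuous
    { toFun := fun u =>
        ⟨fun t => ∫ s in (0 : ℝ)..t, ContinuousMap.IccExtend zero_le_one u s,
          (intervalIntegral.continuous_primitive (fun a b =>
            (ContinuousMap.continuous _).intervalIntegrable a b) 0).comp continuous_subtype_val⟩
      map_add' := fun u v => by
        ext t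
        simp only [ContinuousMap.coe_mk, ContinuousMap.add_apply]
        rw [← intervalIntegral.integral_add
          ((ContinuousMap.continuous _).intervalIntegrable _ _)
          ((ContinuousMap.continuous _).intervalIntegrable _ _)]
        rfl
      map_smul' := fun c u => by
        ext t
        simp only [ContinuousMap.coe_mk, ContinuousMap.smul_apply, RingHom.id_apply]
        rw [← intervalIntegral.integral_smul]
        rfl } 1
    (fun u => by
      rw [one_mul]
      refine (ContinuousMap.norm_le _ (by positivity)).2 fun t => ?_
      refine (intervalIntegral.norm_integral_le_of_norm_le_const (C := ‖u‖)
        (fun s _ => u.norm_coe_le_norm _)).trans ?_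
      rw [sub_zero, abs_of_nonneg t.2.1]
      exact mul_le_of_le_one_right (norm_nonneg _) t.2.2)

lemma primitiveL_apply (u : C(unitInterval, E)) (t : unitInterval) :
    primitiveL E u t = ∫ s in (0 : ℝ)..t, ContinuousMap.IccExtend zero_le_one u s := rfl

end ContinuousMap

/-! ### Frobenius' theorem by the implicit function theorem for curves. -/

namespace Frobenius

universe u

variable {E F : Type u} [NormedAddCommGroup E] [NormedSpace ℝ E]
  [NormedAddCommGroup F] [NormedSpace ℝ F]

/-- Superposition with the family of operators `B`. -/
noncomputable def superpose {B : E → F →L[ℝ] E} (hB : ContDiff ℝ ∞ B)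
    (u : C(unitInterval, E)) : C(unitInterval, F →L[ℝ] E) :=
  (⟨B, hB.continuous⟩ : C(E, F →L[ℝ] E)).comp u

/-- Superposition with the derivative of the family of operators `B`. -/
noncomputable def superposeDeriv {B : E → F →L[ℝ] E} (hB : ContDiff ℝ ∞ B)
    (u : C(unitInterval, E)) : C(unitInterval, E →L[ℝ] F →L[ℝ] E) :=
  (⟨fderiv ℝ B, hB.continuous_fderiv (by simp)⟩ : C(E, E →L[ℝ] F →L[ℝ] E)).comp u

/-- The defect of the curve `u` with `u 0 = q` as a solution of `u' = - B u (P (q - p))`. -/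
noncomputable def defect {B : E → F →L[ℝ] E} (hB : ContDiff ℝ ∞ B) (P : E →L[ℝ] F) (p : E)
    (x : E × C(unitInterval, E)) : C(unitInterval, E) :=
  x.2 - ContinuousMap.constL _ E x.1 + ContinuousMap.primitiveL E
    (ContinuousMap.applyL (superpose hB x.2) (ContinuousMap.constL _ F (P (x.1 - p))))

variable {B : E → F →L[ℝ] E} (hB : ContDiff ℝ ∞ B) (P : E →L[ℝ] F) (p : E)

lemma contDiff_superpose : ContDiff ℝ ∞ (superpose hB) :=
  ContinuousMap.contDiff_comp_left hB

lemma contDiff_defect : ContDiff ℝ ∞ (defect hB P p) := by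
  have h1 := (contDiff_superpose hB).comp
    (contDiff_snd (𝕜 := ℝ) (E := E) (F := C(unitInterval, E)))
  have h2 : ContDiff ℝ ∞ (fun x : E × C(unitInterval, E) =>
      ContinuousMap.constL unitInterval F (P (x.1 - p))) := by fun_prop
  exact (contDiff_snd.sub ((ContinuousMap.constL _ E).contDiff.comp contDiff_fst)).add
    ((ContinuousMap.primitiveL E).contDiff.comp
      (((ContinuousMap.applyL).contDiff.comp h1).clm_apply h2))

/-- The vanishing of this expression is the linearised integral equation: V is the variation of the
curve u when its starting point q is moved by δ. -/
lemma fderiv_defect_apply (q δ : E) (u V : C(unitInterval, E)) :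
    fderiv ℝ (defect hB P p) (q, u) (δ, V) = V - ContinuousMap.constL _ E δ +
      ContinuousMap.primitiveL E
        (ContinuousMap.applyL (superpose hB u) (ContinuousMap.constL _ F (P δ)) +
          ContinuousMap.applyL (ContinuousMap.applyL (superposeDeriv hB u) V)
            (ContinuousMap.constL _ F (P (q - p)))) := by
  have h1 : HasFDerivAt (superpose hB) (ContinuousMap.applyL (superposeDeriv hB u)) u :=
    ContinuousMap.hasFDerivAt_comp_left (hB.differentiable (by simp)) _ u
  have h0 : HasFDerivAt (fun x : E × C(unitInterval, E) => superpose hB x.2) _ (q, u) :=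
    HasFDerivAt.comp (g := superpose hB) (q, u) h1 (hasFDerivAt_snd (𝕜 := ℝ) (p := (q, u)))
  have h1' := HasFDerivAt.comp (g := ContinuousMap.applyL (K := unitInterval) (E := F) (F := E))
    (q, u) (ContinuousLinearMap.hasFDerivAt _) h0
  have h2 : HasFDerivAt (fun x : E × C(unitInterval, E) =>
      ContinuousMap.constL unitInterval F (P (x.1 - p)))
      ((ContinuousMap.constL unitInterval F).comp (P.comp (ContinuousLinearMap.fst ℝ E _)))
      (q, u) :=
    ((ContinuousMap.constL unitInterval F).comp P).hasFDerivAt.comp (q, u)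
      (hasFDerivAt_fst.sub_const p)
  have h3 := (hasFDerivAt_snd (𝕜 := ℝ) (p := (q, u))).sub
    ((ContinuousMap.constL unitInterval E).hasFDerivAt.comp (q, u)
      (hasFDerivAt_fst (𝕜 := ℝ) (p := (q, u))))
  have h4 := h3.add ((ContinuousMap.primitiveL E).hasFDerivAt.comp (q, u) (h1'.clm_apply h2))
  have h5 : HasFDerivAt (defect hB P p) _ (q, u) := h4
  rw [h5.fderiv]
  rfl

lemma defect_const : defect hB P p (p, ContinuousMap.constL _ E p) = 0 := by
  simp [defect]

/-- For a smooth field of operators `B`, each right inverse to `P`, whose ranges form an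
integrable distribution, there is a smooth map constant along the leaves, whose derivative at the
base point is the projection along the distribution. -/
theorem exists_first_integral {B : E → F →L[ℝ] E} (hB : ContDiff ℝ ∞ B) (P : E →L[ℝ] F) (p : E)
    [CompleteSpace E]
    (hPB : ∀ᶠ q in 𝓝 p, ∀ ξ, P (B q ξ) = ξ)
    (hint : ∀ᶠ q in 𝓝 p, ∀ ξ η, fderiv ℝ B q (B q η) ξ = fderiv ℝ B q (B q ξ) η) :
    ∃ h : E → E, (∀ᶠ q in 𝓝 p, ContDiffAt ℝ ∞ h q) ∧
      (∀ᶠ q in 𝓝 p, ∀ ξ, fderiv ℝ h q (B q ξ) = 0) ∧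
      ∀ v, fderiv ℝ h p v = v - B p (P v) := by
  have hΦ := contDiff_defect hB P p
  -- At q = p the factor P (q - p) is zero, so the partial derivative in the curve variable is the
  -- identity.
  have hinv : (fderiv ℝ (defect hB P p) (p, ContinuousMap.constL _ E p) ∘L
      .inr ℝ E C(unitInterval, E)).IsInvertible := by
    refine ⟨ContinuousLinearEquiv.refl ℝ _, ?_⟩
    ext1 V
    simp [fderiv_defect_apply]
  -- U q is the curve that starts at q and moves along the distribution with P-velocity -P (q - p).
  -- While P ∘ B is the identity along it, its P-component goes linearly from P q to P p. Its
  -- endpoint at time 1, on the transversal P = P p, labels the leaf and will be h q.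
  set U := (hΦ.contDiffAt (x := (p, ContinuousMap.constL _ E p))).implicitFunction (by simp) hinv
    with hU
  have hUp : U p = ContinuousMap.constL _ E p :=
    ContDiffAt.implicitFunction_apply_self hΦ.contDiffAt (by simp) hinv
  have hUs : ContDiffAt ℝ ∞ U p :=
    ContDiffAt.contDiffAt_implicitFunction hΦ.contDiffAt (by simp) hinv
  have hU0 : ∀ᶠ q in 𝓝 p, defect hB P p (q, U q) = 0 := by
    have := ContDiffAt.eventually_apply_implicitFunction hΦ.contDiffAt (by simp) hinv
    rwa [defect_const] at this
  have hUd : ∀ᶠ q in 𝓝 p, DifferentiableAt ℝ U q := by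
    filter_upwards [(hUs.of_le (m := 1) (by simp)).eventually (by simp)] with q hq
      using hq.differentiableAt (by simp)
  have hlin : ∀ᶠ q in 𝓝 p, ∀ δ, fderiv ℝ (defect hB P p) (q, U q) (δ, fderiv ℝ U q δ) = 0 := by
    filter_upwards [hU0.eventually_nhds, hUd] with q hq hqd δ
    have h1 : HasFDerivAt (fun q => defect hB P p (q, U q)) _ q :=
      HasFDerivAt.comp (g := defect hB P p) q (hΦ.differentiable (by simp) (q, U q)).hasFDerivAt
        ((hasFDerivAt_id q).prodMk hqd.hasFDerivAt)
    have h2 : HasFDerivAt (fun q => defect hB P p (q, U q)) (0 : E →L[ℝ] C(unitInterval, E)) q :=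
      (hasFDerivAt_const (0 : C(unitInterval, E)) q).congr_of_eventuallyEq hq
    exact DFunLike.congr_fun (h1.unique h2) δ
  have hiso : ∀ᶠ q in 𝓝 p, (fderiv ℝ (defect hB P p) (q, U q) ∘L
      .inr ℝ E C(unitInterval, E)).IsInvertible := by
    have hc : ContinuousAt (fun q => fderiv ℝ (defect hB P p) (q, U q) ∘L
        .inr ℝ E C(unitInterval, E)) p := by
      have : ContinuousAt (fun q => fderiv ℝ (defect hB P p) (q, U q)) p :=
        ContinuousAt.comp (f := fun q => (q, U q)) (hΦ.continuous_fderiv (by simp)).continuousAt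
          (continuousAt_id.prodMk hUs.continuousAt)
      exact this.clm_comp continuousAt_const
    obtain ⟨e, he⟩ := hinv
    exact hc.eventually (p := fun A => A ∈ Set.range ((↑) :
        (C(unitInterval, E) ≃L[ℝ] C(unitInterval, E)) →
          C(unitInterval, E) →L[ℝ] C(unitInterval, E)))
      (by beta_reduce; rw [hUp, ← he]; exact ContinuousLinearEquiv.nhds e)
  have hinj : ∀ᶠ q in 𝓝 p, ∀ V, fderiv ℝ (defect hB P p) (q, U q) (0, V) = 0 → V = 0 := by
    filter_upwards [hiso] with q ⟨e', he'⟩ V hV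
    have h0 : e' V = 0 := by
      rw [← ContinuousLinearEquiv.coe_coe, he']; simpa using hV
    simpa using h0
  -- Infinite differentiability at p alone does not spread to nearby points. The implicit function
  -- theorem is therefore applied again at (q, U q), and local uniqueness identifies the new
  -- solution with U.
  have hUe : ∀ᶠ q in 𝓝 p, ContDiffAt ℝ ∞ U q := by
    filter_upwards [hiso, hUd, hU0.eventually_nhds] with q hq hqd hq0
    have h1 := ContDiffAt.eventually_apply_eq_iff_implicitFunction
      (hΦ.contDiffAt (x := (q, U q))) (by simp) hq
    have h2 := (continuousAt_id.prodMk hqd.continuousAt).eventually h1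
    refine (ContDiffAt.contDiffAt_implicitFunction
      (hΦ.contDiffAt (x := (q, U q))) (by simp) hq).congr_of_eventuallyEq ?_
    filter_upwards [h2, hq0] with q' h3 h4
    exact (h3.1 (h4.trans hq0.self_of_nhds.symm)).symm
  have hnear : ∀ᶠ q in 𝓝 p, ∀ s, ∀ ξ η,
      fderiv ℝ B (U q s) (B (U q s) η) ξ = fderiv ℝ B (U q s) (B (U q s) ξ) η := by
    obtain ⟨ε, hε, hε'⟩ := Metric.eventually_nhds_iff.1 hint
    filter_upwards [Metric.continuousAt_iff'.1 hUs.continuousAt ε hε] with q hq s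
    refine hε' ?_
    rw [hUp] at hq
    exact (ContinuousMap.dist_apply_le_dist s).trans_lt hq
  let ev : C(unitInterval, E) →L[ℝ] E := ContinuousMap.evalCLM ℝ 1
  refine ⟨fun q => ev (U q), hUe.mono fun q hq =>
    ev.contDiff.contDiffAt.comp q hq, ?_, ?_⟩
  · filter_upwards [hPB, hU0, hUd, hlin, hinj, hnear] with q hPq hq0 hqd hql hqi hqn ξ
    have hder : fderiv ℝ (fun q => ev (U q)) q (B q ξ) = fderiv ℝ U q (B q ξ) 1 := by
      have : HasFDerivAt (fun q => ev (U q)) _ q := ev.hasFDerivAt.comp q hqd.hasFDerivAt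
      rw [this.fderiv]; rfl
    rw [hder]
    set x := P (q - p)
    let g : C(unitInterval, E) :=
      ContinuousMap.applyL (superpose hB (U q)) (ContinuousMap.constL _ F x)
    let W : ℝ → E := fun t => q - ∫ s in (0 : ℝ)..t, ContinuousMap.IccExtend zero_le_one g s
    have hW : ∀ t : unitInterval, U q t = W t := by
      intro t
      have := DFunLike.congr_fun hq0 t
      simp only [defect, ContinuousMap.add_apply, ContinuousMap.sub_apply,
        ContinuousMap.constL_apply, ContinuousMap.primitiveL_apply,
        ContinuousMap.zero_apply] at this
      rw [eq_sub_iff_add_eq, ← sub_eq_zero, ← this]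
      simp only [g, x]
      abel
    have hWd : ∀ t : ℝ, HasDerivAt W (-ContinuousMap.IccExtend zero_le_one g t) t := fun t =>
      ((ContinuousMap.continuous _).integral_hasStrictDerivAt 0 t).hasDerivAt.const_sub q
    have hgt : ∀ t : unitInterval, ContinuousMap.IccExtend zero_le_one g t = B (W t) x := by
      intro t
      rw [← hW, ContinuousMap.coe_IccExtend, Set.IccExtend_val]
      rfl
    -- Guess for the variation of the curve when q moves by B q ξ: the moved curve follows the same
    -- leaf, and its P-displacement ξ shrinks linearly to zero. The integrability condition makes V
    -- solve the linearised equation; injectivity of the partial derivative then identifies it with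
    -- the true variation, and V vanishes at time 1.
    let V : C(unitInterval, E) := ⟨fun t => (1 - (t : ℝ)) • B (U q t) ξ, by
      have := hB.continuous.comp (U q).continuous
      have h2 := this.clm_apply (continuous_const (y := ξ))
      exact (continuous_const.sub continuous_subtype_val).smul h2⟩
    have hV : fderiv ℝ (defect hB P p) (q, U q) (B q ξ, V) = 0 := by
      rw [fderiv_defect_apply]
      ext t
      simp only [ContinuousMap.add_apply, ContinuousMap.sub_apply,
        ContinuousMap.constL_apply, ContinuousMap.primitiveL_apply,
        ContinuousMap.zero_apply, hPq]
      have hd : ∀ s : ℝ, HasDerivAt (fun t => (1 - t) • B (W t) ξ)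
          ((1 - s) • (fderiv ℝ B (W s) (-ContinuousMap.IccExtend zero_le_one g s)) ξ +
            (-1 : ℝ) • B (W s) ξ) s := by
        intro s
        have h1 : HasDerivAt (fun t => B (W t)) _ s :=
          (hB.differentiable (by simp) (W s)).hasFDerivAt.comp_hasDerivAt s (hWd s)
        have h2 := h1.clm_apply (hasDerivAt_const s ξ)
        simp only [map_zero, add_zero] at h2
        exact ((hasDerivAt_id s).const_sub 1).smul h2
      have hcW : Continuous W := continuous_iff_continuousAt.2 fun t => (hWd t).continuousAt
      have hint' : Continuous fun s => ((1 - s) •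
          (fderiv ℝ B (W s) (-ContinuousMap.IccExtend zero_le_one g s)) ξ +
            (-1 : ℝ) • B (W s) ξ) := by
        have h1 := (hB.continuous_fderiv (by simp)).comp hcW
        have h2 := (h1.clm_apply (ContinuousMap.IccExtend zero_le_one g).continuous.neg).clm_apply
          (continuous_const (y := ξ))
        have h3 := (hB.continuous.comp hcW).clm_apply (continuous_const (y := ξ))
        exact ((continuous_const.sub continuous_id).smul h2).add (h3.const_smul _)
      have hFTC := intervalIntegral.integral_eq_sub_of_hasDerivAt (a := 0) (b := t)
        (fun s _ => hd s) (hint'.intervalIntegrable _ _)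
      have hW0 : W 0 = q := by simp [W]
      have hneg : ∫ s in (0 : ℝ)..t, ContinuousMap.IccExtend zero_le_one
          (ContinuousMap.applyL (superpose hB (U q)) (ContinuousMap.constL _ F ξ) +
            ContinuousMap.applyL (ContinuousMap.applyL (superposeDeriv hB (U q)) V)
              (ContinuousMap.constL _ F x)) s =
          -∫ s in (0 : ℝ)..t, ((1 - s) •
            (fderiv ℝ B (W s) (-ContinuousMap.IccExtend zero_le_one g s)) ξ +
            (-1 : ℝ) • B (W s) ξ) := by
        rw [← intervalIntegral.integral_neg]
        refine intervalIntegral.integral_congr fun s hs => ?_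
        rw [Set.uIcc_of_le t.2.1] at hs
        have hsI : s ∈ unitInterval := ⟨hs.1, hs.2.trans t.2.2⟩
        lift s to unitInterval using hsI
        simp only [hgt]
        rw [ContinuousMap.coe_IccExtend, Set.IccExtend_val]
        have hs1 := hqn s x ξ
        rw [hW] at hs1
        simp only [ContinuousMap.add_apply, ContinuousMap.applyL_apply,
          ContinuousMap.constL_apply, superpose, superposeDeriv, ContinuousMap.comp_apply,
          ContinuousMap.coe_mk, V, hW, map_smul, map_neg, _root_.smul_apply,
          _root_.neg_apply, hs1]
        module
      rw [hneg, hFTC, hW0]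
      simp only [V, ContinuousMap.coe_mk, hW]
      module
    have := hqi (fderiv ℝ U q (B q ξ) - V) (by
      have h1 := congrArg₂ (· - ·) (hql (B q ξ)) hV
      simp only [← map_sub, Prod.mk_sub_mk, sub_self] at h1
      exact h1)
    rw [sub_eq_zero.1 this]
    simp [V]
  · intro v
    have hder : fderiv ℝ (fun q => ev (U q)) p v = fderiv ℝ U p v 1 := by
      have : HasFDerivAt (fun q => ev (U q)) _ p :=
        ev.hasFDerivAt.comp p hUd.self_of_nhds.hasFDerivAt
      rw [this.fderiv]; rfl
    -- At p the curve is constant, and the linearised equation integrates explicitly to v - t B p (P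
    -- v).
    have h1 := DFunLike.congr_fun (hlin.self_of_nhds v) 1
    rw [fderiv_defect_apply] at h1
    simp only [hUp, sub_self, map_zero, add_zero, ContinuousMap.add_apply,
      ContinuousMap.sub_apply, ContinuousMap.constL_apply, ContinuousMap.primitiveL_apply,
      ContinuousMap.zero_apply] at h1
    have h2 : ∀ s : ℝ, ContinuousMap.IccExtend zero_le_one
        (ContinuousMap.applyL (superpose hB (ContinuousMap.constL unitInterval E p))
          (ContinuousMap.constL _ F (P v))) s = B p (P v) := fun s => rfl
    simp only [h2, intervalIntegral.integral_const] at h1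
    rw [hder, eq_sub_iff_add_eq, ← sub_eq_zero, ← h1]
    simp
    abel

end Frobenius

/-- A smooth map on a neighbourhood of `p` agrees near `p` with a globally smooth map. -/
lemma ContDiffOn.exists_contDiff_eventuallyEq {E F : Type*} [NormedAddCommGroup E]
    [NormedSpace ℝ E] [FiniteDimensional ℝ E] [NormedAddCommGroup F] [NormedSpace ℝ F]
    {g : E → F} {V : Set E} {p : E} (hg : ContDiffOn ℝ ∞ g V) (hV : IsOpen V) (hp : p ∈ V) :
    ∃ g' : E → F, ContDiff ℝ ∞ g' ∧ g' =ᶠ[𝓝 p] g := by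
  obtain ⟨ε, hε, hεV⟩ := Metric.nhds_basis_closedBall.mem_iff.1 (hV.mem_nhds hp)
  let c : ContDiffBump p := ⟨ε / 2, ε, by positivity, by linarith⟩
  refine ⟨fun q => c q • g q, contDiff_iff_contDiffAt.2 fun x => ?_, ?_⟩
  · by_cases hx : x ∈ V
    · exact c.contDiffAt.smul (hg.contDiffAt (hV.mem_nhds hx))
    · have hx' : x ∈ (tsupport c)ᶜ := by
        rw [c.tsupport_eq]
        exact fun h => hx (hεV h)
      have h0 : (fun q => c q • g q) =ᶠ[𝓝 x] fun _ => 0 := by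
        filter_upwards [(isClosed_tsupport c).isOpen_compl.mem_nhds hx'] with y hy
        rw [image_eq_zero_of_notMem_tsupport hy, zero_smul]
      exact contDiffAt_const.congr_of_eventuallyEq h0
  · filter_upwards [c.eventuallyEq_one] with y hy
    rw [hy, Pi.one_apply, one_smul]

/-! ### From an involutive frame to first integrals. -/

namespace Frobenius

variable {E : Type} [NormedAddCommGroup E] [NormedSpace ℝ E]

/-- The operator sending the coordinates in the family `f` to the corresponding vector. -/
noncomputable def frameL {r : ℕ} (f : Fin r → E → E) (q : E) : (Fin r → ℝ) →L[ℝ] E :=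
  ∑ j, (ContinuousLinearMap.proj (R := ℝ) (φ := fun _ : Fin r => ℝ) j).smulRight (f j q)

lemma frameL_apply {r : ℕ} (f : Fin r → E → E) (q : E) (ξ : Fin r → ℝ) :
    frameL f q ξ = ∑ j, ξ j • f j q := by
  simp [frameL]

lemma frameL_mem {r : ℕ} (f : Fin r → E → E) (q : E) (ξ : Fin r → ℝ) :
    frameL f q ξ ∈ Submodule.span ℝ (Set.range fun j => f j q) := by
  rw [frameL_apply]
  exact Submodule.sum_mem _ fun j _ => Submodule.smul_mem _ _ (Submodule.subset_span ⟨j, rfl⟩)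

lemma exists_frameL_eq {r : ℕ} (f : Fin r → E → E) (q : E) {v : E}
    (hv : v ∈ Submodule.span ℝ (Set.range fun j => f j q)) : ∃ ξ, frameL f q ξ = v := by
  obtain ⟨ξ, rfl⟩ := (Submodule.mem_span_range_iff_exists_fun ℝ).1 hv
  exact ⟨ξ, frameL_apply f q ξ⟩

lemma contDiffOn_frameL {r : ℕ} {f : Fin r → E → E} {V : Set E}
    (hf : ∀ j, ContDiffOn ℝ ∞ (f j) V) : ContDiffOn ℝ ∞ (frameL f) V :=
  ContDiffOn.sum fun j _ => contDiffOn_const.smulRight (hf j)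

/-- **Frobenius' theorem**, in terms of first integrals: near a point, an involutive
distribution is annihilated by the derivative of a smooth map, and at the given point it is the
kernel of this derivative. -/
theorem exists_first_integral_of_involutive [FiniteDimensional ℝ E] {r : ℕ} {V : Set E} {p : E}
    (hV : IsOpen V) (hp : p ∈ V) (f : Fin r → E → E) (hf : ∀ j, ContDiffOn ℝ ∞ (f j) V)
    (hli : LinearIndependent ℝ fun j => f j p)
    (hbr : ∀ (W : Set E) (X Y : E → E), IsOpen W → W ⊆ V →
      ContDiffOn ℝ ∞ X W → ContDiffOn ℝ ∞ Y W →
      (∀ q ∈ W, X q ∈ Submodule.span ℝ (Set.range fun j => f j q)) →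
      (∀ q ∈ W, Y q ∈ Submodule.span ℝ (Set.range fun j => f j q)) →
      ∀ q ∈ W, VectorField.lieBracket ℝ X Y q ∈ Submodule.span ℝ (Set.range fun j => f j q)) :
    ∃ h : E → E, (∀ᶠ q in 𝓝 p, ContDiffAt ℝ ∞ h q) ∧
      (∀ᶠ q in 𝓝 p, ∀ j, fderiv ℝ h q (f j q) = 0) ∧
      ∀ v, fderiv ℝ h p v = 0 → v ∈ Submodule.span ℝ (Set.range fun j => f j p) := by
  have hker : LinearMap.ker (frameL f p : (Fin r → ℝ) →ₗ[ℝ] E) = ⊥ := by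
    refine LinearMap.ker_eq_bot'.2 fun ξ hξ => funext fun j => ?_
    rw [ContinuousLinearMap.coe_coe, frameL_apply] at hξ
    exact Fintype.linearIndependent_iff.1 hli ξ hξ j
  obtain ⟨P₀, hP₀⟩ := LinearMap.exists_leftInverse_of_injective _ hker
  let P : E →L[ℝ] (Fin r → ℝ) := LinearMap.toContinuousLinearMap P₀
  have hA := contDiffOn_frameL hf
  let C : E → (Fin r → ℝ) →L[ℝ] (Fin r → ℝ) := fun q => P ∘L frameL f q
  have hC : ContDiffOn ℝ ∞ C V := contDiffOn_const.clm_comp hA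
  have hCp : C p = ContinuousLinearMap.id ℝ _ := by
    ext1 ξ
    exact DFunLike.congr_fun hP₀ ξ
  set R : Set ((Fin r → ℝ) →L[ℝ] (Fin r → ℝ)) := Set.range
    ((↑) : ((Fin r → ℝ) ≃L[ℝ] (Fin r → ℝ)) → (Fin r → ℝ) →L[ℝ] (Fin r → ℝ)) with hR
  have hRo : IsOpen R := ContinuousLinearEquiv.isOpen
  have hW : IsOpen (V ∩ C ⁻¹' R) := hC.continuousOn.isOpen_inter_preimage hV hRo
  have hpW : p ∈ V ∩ C ⁻¹' R := ⟨hp, by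
    rw [Set.mem_preimage, hCp]; exact ⟨ContinuousLinearEquiv.refl ℝ _, rfl⟩⟩
  -- The frame is renormalised so that its P-components are constant; this makes the brackets of its
  -- fields lie in the kernel of P.
  let B₀ : E → (Fin r → ℝ) →L[ℝ] E := fun q => frameL f q ∘L (C q).inverse
  have hB₀ : ContDiffOn ℝ ∞ B₀ (V ∩ C ⁻¹' R) := by
    refine (hA.mono Set.inter_subset_left).clm_comp fun q hq => ?_
    obtain ⟨e, he⟩ := hq.2
    have h1 := contDiffAt_map_inverse (n := ∞) (𝕜 := ℝ) e
    rw [he] at h1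
    exact h1.comp_contDiffWithinAt q ((hC.mono Set.inter_subset_left) q hq)
  -- Superposition on all continuous curves needs a field of operators that is smooth on the whole
  -- space; only its germ at p matters afterwards.
  obtain ⟨B, hB, hBB₀⟩ := hB₀.exists_contDiff_eventuallyEq hW hpW
  obtain ⟨W', hW'sub, hW', hpW'⟩ := eventually_nhds_iff.1 hBB₀
  set W := (V ∩ C ⁻¹' R) ∩ W' with hWdef
  have hWo : IsOpen W := hW.inter hW'
  have hpWW : p ∈ W := ⟨hpW, hpW'⟩
  have hWn : W ∈ 𝓝 p := hWo.mem_nhds hpWW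
  have hBmem : ∀ q ∈ W, ∀ ξ, B q ξ ∈ Submodule.span ℝ (Set.range fun j => f j q) := by
    intro q hq ξ
    rw [hW'sub q hq.2]
    exact frameL_mem _ _ _
  have hPB : ∀ q ∈ W, ∀ ξ, P (B q ξ) = ξ := by
    intro q hq ξ
    rw [hW'sub q hq.2]
    obtain ⟨e, he⟩ := hq.1.2
    change C q ((C q).inverse ξ) = ξ
    rw [← he, ContinuousLinearMap.inverse_equiv]
    exact e.apply_symm_apply ξ
  have hBsurj : ∀ q ∈ W, ∀ v ∈ Submodule.span ℝ (Set.range fun j => f j q), B q (P v) = v := by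
    intro q hq v hv
    obtain ⟨ξ, rfl⟩ := exists_frameL_eq f q hv
    rw [hW'sub q hq.2]
    obtain ⟨e, he⟩ := hq.1.2
    change frameL f q ((C q).inverse (C q ξ)) = _
    rw [← he, ContinuousLinearMap.inverse_equiv]
    exact congrArg _ (e.symm_apply_apply ξ)
  have hBd : ∀ ξ q, HasFDerivAt (fun q => B q ξ) ((fderiv ℝ B q).flip ξ) q := by
    intro ξ q
    have := (hB.differentiable (by simp) q).hasFDerivAt.clm_apply (hasFDerivAt_const ξ q)
    simpa using this
  -- P ∘ B is locally constant, so P kills every derivative of B. The bracket of two fields B η and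
  -- B ξ thus lies both in the kernel of P and, by involutivity, in the distribution, on which P is
  -- injective. Hence it is zero, which is the integrability condition.
  have hPd : ∀ q ∈ W, ∀ v ξ, P (fderiv ℝ B q v ξ) = 0 := by
    intro q hq v ξ
    have h1 : HasFDerivAt (fun q => P (B q ξ)) _ q := P.hasFDerivAt.comp q (hBd ξ q)
    have h2 : HasFDerivAt (fun q => P (B q ξ)) (0 : E →L[ℝ] (Fin r → ℝ)) q := by
      refine (hasFDerivAt_const ξ q).congr_of_eventuallyEq ?_
      filter_upwards [hWo.mem_nhds hq] with q' hq' using hPB q' hq' ξ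
    exact DFunLike.congr_fun (h1.unique h2) v
  obtain ⟨h, hh1, hh2, hh3⟩ := exists_first_integral hB P p
    (by filter_upwards [hWn] with q hq using hPB q hq)
    (by
      filter_upwards [hWn] with q hq ξ η
      have h1 := hbr W (fun q => B q η) (fun q => B q ξ) hWo (fun q hq => hq.1.1)
        (hB.clm_apply contDiff_const).contDiffOn (hB.clm_apply contDiff_const).contDiffOn
        (fun q hq => hBmem q hq η) (fun q hq => hBmem q hq ξ) q hq
      have h2 : VectorField.lieBracket ℝ (fun q => B q η) (fun q => B q ξ) q =
          fderiv ℝ B q (B q η) ξ - fderiv ℝ B q (B q ξ) η := by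
        rw [VectorField.lieBracket, (hBd ξ q).fderiv, (hBd η q).fderiv]
        rfl
      have h3 := hBsurj q hq _ h1
      rw [h2, map_sub, hPd q hq, hPd q hq, sub_zero, map_zero] at h3
      exact sub_eq_zero.1 h3.symm)
  refine ⟨h, hh1, ?_, fun v hv => ?_⟩
  · filter_upwards [hh2, hWn] with q hq hqW j
    have h1 : f j q ∈ Submodule.span ℝ (Set.range fun j => f j q) :=
      Submodule.subset_span ⟨j, rfl⟩
    rw [← hBsurj q hqW _ h1]
    exact hq _
  · rw [hh3, sub_eq_zero] at hv
    rw [hv]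
    exact hBmem p hpWW _

end Frobenius

/-! ### Elementary properties of modules of vector fields and of the two flags. -/

namespace PlaneField

section Modules

variable {E H : Type*} [NormedAddCommGroup E] [NormedSpace ℝ E] [TopologicalSpace H]
  {I : ModelWithCorners ℝ E H} {M : Type*} [TopologicalSpace M] [ChartedSpace H M]
  [IsManifold I ∞ M]

lemma IsSmoothOn.mono {X : RawVectorField I M} {U V : Set M} (h : IsSmoothOn X U) (hVU : V ⊆ U) :
    IsSmoothOn X V :=
  ContMDiffOn.mono h hVU

lemma IsSmoothOn.congr {X Y : RawVectorField I M} {U : Set M} (h : IsSmoothOn X U)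
    (hXY : ∀ p ∈ U, Y p = X p) : IsSmoothOn Y U :=
  ContMDiffOn.congr h fun p hp => by rw [hXY p hp]

lemma IsSmoothOn.sum_smul {U : Set M} {k : ℕ} {a : Fin k → M → ℝ} {Y : Fin k → RawVectorField I M}
    (ha : ∀ j, ContMDiffOn I 𝓘(ℝ, ℝ) ∞ (a j) U) (hY : ∀ j, IsSmoothOn (Y j) U) :
    IsSmoothOn (fun p => ∑ j, a j p • Y j p) U :=
  ContMDiffOn.sum_section fun j _ => (ha j).smul_section (hY j)

lemma IsSmoothOn.mlieBracket [CompleteSpace E] {U : TopologicalSpace.Opens M}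
    {X Y : RawVectorField I M} (hX : IsSmoothOn X U) (hY : IsSmoothOn Y U) :
    IsSmoothOn (VectorField.mlieBracket I X Y) U := by
  have : IsManifold I (((⊤ : ℕ∞) : WithTop ℕ∞) + 1) M := by simpa using ‹IsManifold I ∞ M›
  have : IsManifold I (minSmoothness ℝ 2) M := by
    rw [minSmoothness_of_isRCLikeNormedField]; infer_instance
  intro p hp
  refine ContMDiffAt.contMDiffWithinAt ?_
  have hU := U.isOpen.mem_nhds hp
  exact ContMDiffAt.mlieBracket_vectorField (n := ⊤) (m := ⊤) (ContMDiffOn.contMDiffAt hX hU)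
    (ContMDiffOn.contMDiffAt hY hU) (by simp)

omit [IsManifold I ∞ M] in
lemma moduleSpan_congr {U : TopologicalSpace.Opens M} {S : Set (RawVectorField I M)}
    {X Y : RawVectorField I M} (hX : X ∈ moduleSpan U S) (h : ∀ p ∈ U, Y p = X p) :
    Y ∈ moduleSpan U S := by
  obtain ⟨k, a, Z, ha, hZ, hX⟩ := hX
  exact ⟨k, a, Z, ha, hZ, fun p hp => (h p hp).trans (hX p hp)⟩

omit [IsManifold I ∞ M] in
lemma subset_moduleSpan (U : TopologicalSpace.Opens M) (S : Set (RawVectorField I M)) :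
    S ⊆ moduleSpan U S := fun X hX =>
  ⟨1, fun _ _ => 1, fun _ => X, fun _ => contMDiffOn_const, fun _ => hX, fun p _ => by simp⟩

omit [IsManifold I ∞ M] in
lemma moduleSpan_mono (U : TopologicalSpace.Opens M) {S T : Set (RawVectorField I M)}
    (h : S ⊆ T) : moduleSpan U S ⊆ moduleSpan U T := by
  rintro X ⟨k, a, Z, ha, hZ, hX⟩
  exact ⟨k, a, Z, ha, fun j => h (hZ j), hX⟩

omit [IsManifold I ∞ M] in
lemma moduleSpan_mono_open {U V : TopologicalSpace.Opens M} (hVU : V ≤ U)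
    (S : Set (RawVectorField I M)) : moduleSpan U S ⊆ moduleSpan V S := by
  rintro X ⟨k, a, Z, ha, hZ, hX⟩
  exact ⟨k, a, Z, fun j => (ha j).mono hVU, hZ, fun p hp => hX p (hVU hp)⟩

lemma isSmoothOn_of_mem_moduleSpan {U : TopologicalSpace.Opens M}
    {S : Set (RawVectorField I M)} (hS : ∀ X ∈ S, IsSmoothOn X U) {X : RawVectorField I M}
    (hX : X ∈ moduleSpan U S) : IsSmoothOn X U := by
  obtain ⟨k, a, Z, ha, hZ, hX⟩ := hX
  exact (IsSmoothOn.sum_smul ha fun j => hS _ (hZ j)).congr hX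

lemma sectionsOn_mono (D : PlaneField I M) {U V : TopologicalSpace.Opens M} (hVU : V ≤ U) :
    D.sectionsOn U ⊆ D.sectionsOn V :=
  fun _ hX => ⟨hX.1.mono hVU, fun p hp => hX.2 p (hVU hp)⟩

omit [IsManifold I ∞ M] in
lemma brackets_mono {A A' B B' : Set (RawVectorField I M)} (hA : A ⊆ A') (hB : B ⊆ B') :
    brackets A B ⊆ brackets A' B' := by
  rintro Z ⟨X, hX, Y, hY, rfl⟩
  exact ⟨X, hA hX, Y, hB hY, rfl⟩

lemma derivedModule_mono (D : PlaneField I M) {U V : TopologicalSpace.Opens M} (hVU : V ≤ U)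
    (i : ℕ) : D.derivedModule U i ⊆ D.derivedModule V i := by
  induction i with
  | zero => exact sectionsOn_mono D hVU
  | succ i ih =>
    exact (moduleSpan_mono_open hVU _).trans
      (moduleSpan_mono _ (Set.union_subset_union ih (brackets_mono ih ih)))

lemma derivedModule_congr (D : PlaneField I M) {U : TopologicalSpace.Opens M} {i : ℕ}
    {X Y : RawVectorField I M} (hX : X ∈ D.derivedModule U i) (h : ∀ p ∈ U, Y p = X p) :
    Y ∈ D.derivedModule U i := by
  cases i with
  | zero => exact ⟨hX.1.congr h, fun p hp => h p hp ▸ hX.2 p hp⟩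
  | succ i => exact moduleSpan_congr hX h

lemma derivedModule_subset_succ (D : PlaneField I M) (U : TopologicalSpace.Opens M) (i : ℕ) :
    D.derivedModule U i ⊆ D.derivedModule U (i + 1) :=
  Set.subset_union_left.trans (subset_moduleSpan _ _)

lemma sectionsOn_subset_derivedModule (D : PlaneField I M) (U : TopologicalSpace.Opens M) (i : ℕ) :
    D.sectionsOn U ⊆ D.derivedModule U i := by
  induction i with
  | zero => exact subset_rfl
  | succ i ih => exact ih.trans (derivedModule_subset_succ D U i)

lemma mlieBracket_mem_derivedModule (D : PlaneField I M) {U : TopologicalSpace.Opens M} {i : ℕ}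
    {X Y : RawVectorField I M} (hX : X ∈ D.derivedModule U i) (hY : Y ∈ D.derivedModule U i) :
    VectorField.mlieBracket I X Y ∈ D.derivedModule U (i + 1) :=
  subset_moduleSpan _ _ (Or.inr ⟨X, hX, Y, hY, rfl⟩)

lemma derivedModule_isSmoothOn [CompleteSpace E] (D : PlaneField I M)
    {U : TopologicalSpace.Opens M} {i : ℕ} {X : RawVectorField I M}
    (hX : X ∈ D.derivedModule U i) : IsSmoothOn X U := by
  induction i generalizing X with
  | zero => exact hX.1
  | succ i ih =>
    refine isSmoothOn_of_mem_moduleSpan (fun Y hY => ?_) hX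
    rcases hY with hY | ⟨A, hA, B, hB, rfl⟩
    · exact ih hY
    · exact (ih hA).mlieBracket (ih hB)

lemma lieModule_subset_derivedModule (D : PlaneField I M) (U : TopologicalSpace.Opens M) (i : ℕ) :
    D.lieModule U i ⊆ D.derivedModule U i := by
  induction i with
  | zero => exact subset_rfl
  | succ i ih =>
    exact moduleSpan_mono _ (Set.union_subset_union ih
      (brackets_mono (sectionsOn_subset_derivedModule D U i) ih))

lemma lieFlag_le_derivedFlag (D : PlaneField I M) (i : ℕ) (p : M) :
    D.lieFlag i p ≤ D.derivedFlag i p := by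
  refine Submodule.span_mono ?_
  rintro v ⟨U, hp, X, hX, rfl⟩
  exact ⟨U, hp, X, lieModule_subset_derivedModule D U i hX, rfl⟩

lemma apply_mem_derivedFlag (D : PlaneField I M) {U : TopologicalSpace.Opens M} {i : ℕ} {p : M}
    (hp : p ∈ U) {X : RawVectorField I M} (hX : X ∈ D.derivedModule U i) :
    X p ∈ D.derivedFlag i p :=
  Submodule.subset_span ⟨U, hp, X, hX, rfl⟩

lemma apply_mem_lieFlag (D : PlaneField I M) {U : TopologicalSpace.Opens M} {i : ℕ} {p : M}
    (hp : p ∈ U) {X : RawVectorField I M} (hX : X ∈ D.lieModule U i) :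
    X p ∈ D.lieFlag i p :=
  Submodule.subset_span ⟨U, hp, X, hX, rfl⟩

lemma derivedFlag_le_succ (D : PlaneField I M) (i : ℕ) (p : M) :
    D.derivedFlag i p ≤ D.derivedFlag (i + 1) p := by
  refine Submodule.span_mono ?_
  rintro v ⟨U, hp, X, hX, rfl⟩
  exact ⟨U, hp, X, derivedModule_subset_succ D U i hX, rfl⟩

omit [IsManifold I ∞ M] in
/-- Membership in a plane field only depends on the base point. -/
lemma mem_congr (D : PlaneField I M) {p q : M} (h : p = q) (v : E) :
    (show TangentSpace I p from v) ∈ D p ↔ (show TangentSpace I q from v) ∈ D q := by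
  subst h; rfl

end Modules

/-! ### Invariance of the flags and of involutive subdistributions under local diffeomorphisms. -/

section Pullback

variable {E H : Type*} [NormedAddCommGroup E] [NormedSpace ℝ E] [TopologicalSpace H]
  {I : ModelWithCorners ℝ E H} {M : Type*} [TopologicalSpace M] [ChartedSpace H M]
  [IsManifold I ∞ M]
  {E' H' : Type*} [NormedAddCommGroup E'] [NormedSpace ℝ E'] [TopologicalSpace H']
  {I' : ModelWithCorners ℝ E' H'} {M' : Type*} [TopologicalSpace M'] [ChartedSpace H' M']
  [IsManifold I' ∞ M']

variable (I I') in
/-- A local homeomorphism that is smooth with smooth inverse. -/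
structure IsLocalDiffeo (φ : OpenPartialHomeomorph M M') : Prop where
  smooth : ContMDiffOn I I' ∞ φ φ.source
  smooth_symm : ContMDiffOn I' I ∞ φ.symm φ.target

/-- On the source of `φ`, the plane field `D` is the pullback of `D'`. -/
def IsPullback (φ : OpenPartialHomeomorph M M') (D : PlaneField I M) (D' : PlaneField I' M') :
    Prop :=
  ∀ q ∈ φ.source, D q = (D' (φ q)).comap (mfderiv I I' φ q).toLinearMap

variable {φ : OpenPartialHomeomorph M M'}

namespace IsLocalDiffeo

omit [IsManifold I ∞ M] [IsManifold I' ∞ M'] in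
lemma symm (hφ : IsLocalDiffeo I I' φ) : IsLocalDiffeo I' I φ.symm :=
  ⟨hφ.smooth_symm, hφ.smooth⟩

omit [IsManifold I ∞ M] [IsManifold I' ∞ M'] in
lemma mdifferentiable (hφ : IsLocalDiffeo I I' φ) : φ.MDifferentiable I I' :=
  ⟨hφ.smooth.mdifferentiableOn (by simp), hφ.smooth_symm.mdifferentiableOn (by simp)⟩

omit [IsManifold I ∞ M] [IsManifold I' ∞ M'] in
lemma isInvertible_mfderiv (hφ : IsLocalDiffeo I I' φ) {q : M} (hq : q ∈ φ.source) :
    (mfderiv I I' φ q).IsInvertible :=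
  ⟨hφ.mdifferentiable.mfderiv hq, rfl⟩

omit [IsManifold I ∞ M] [IsManifold I' ∞ M'] in
lemma mfderiv_mpullback (hφ : IsLocalDiffeo I I' φ) {q : M} (hq : q ∈ φ.source)
    (X : RawVectorField I' M') :
    mfderiv I I' φ q (VectorField.mpullback I I' φ X q) = X (φ q) := by
  obtain ⟨e, he⟩ := hφ.isInvertible_mfderiv hq
  rw [VectorField.mpullback_apply, ← he, ContinuousLinearMap.inverse_equiv]
  exact e.apply_symm_apply _

omit [IsManifold I ∞ M] [IsManifold I' ∞ M'] in
lemma mpullback_eq_iff (hφ : IsLocalDiffeo I I' φ) {q : M} (hq : q ∈ φ.source)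
    (X : RawVectorField I' M') (v : TangentSpace I q) :
    VectorField.mpullback I I' φ X q = v ↔ X (φ q) = mfderiv I I' φ q v := by
  rw [← hφ.mfderiv_mpullback hq X]
  exact (hφ.mdifferentiable.mfderiv_injective hq).eq_iff.symm

lemma isSmoothOn_mpullback [CompleteSpace E] (hφ : IsLocalDiffeo I I' φ)
    {U : TopologicalSpace.Opens M} {U' : TopologicalSpace.Opens M'}
    (hU : ∀ q ∈ U, q ∈ φ.source ∧ φ q ∈ U') {X : RawVectorField I' M'} (hX : IsSmoothOn X U') :
    IsSmoothOn (VectorField.mpullback I I' φ X) U := by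
  intro q hq
  obtain ⟨hqs, hqU'⟩ := hU q hq
  refine ContMDiffAt.contMDiffWithinAt ?_
  exact ContMDiffAt.mpullback_vectorField_preimage (n := ∞)
    (ContMDiffOn.contMDiffAt hX (U'.isOpen.mem_nhds hqU'))
    (hφ.smooth.contMDiffAt (φ.open_source.mem_nhds hqs)) (hφ.isInvertible_mfderiv hqs) (by simp)

lemma mpullback_mlieBracket [CompleteSpace E] [CompleteSpace E'] (hφ : IsLocalDiffeo I I' φ)
    {U' : TopologicalSpace.Opens M'} {X Y : RawVectorField I' M'} (hX : IsSmoothOn X U')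
    (hY : IsSmoothOn Y U') {q : M} (hq : q ∈ φ.source) (hqU' : φ q ∈ U') :
    VectorField.mpullback I I' φ (VectorField.mlieBracket I' X Y) q =
      VectorField.mlieBracket I (VectorField.mpullback I I' φ X)
        (VectorField.mpullback I I' φ Y) q := by
  have : IsManifold I (minSmoothness ℝ 2) M := by
    rw [minSmoothness_of_isRCLikeNormedField]; infer_instance
  have : IsManifold I' (minSmoothness ℝ 2) M' := by
    rw [minSmoothness_of_isRCLikeNormedField]; infer_instance
  have hn := U'.isOpen.mem_nhds hqU'
  exact VectorField.mpullback_mlieBracket (n := ∞)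
    ((ContMDiffOn.contMDiffAt hX hn).mdifferentiableAt (by simp))
    ((ContMDiffOn.contMDiffAt hY hn).mdifferentiableAt (by simp))
    (hφ.smooth.contMDiffAt (φ.open_source.mem_nhds hq))
    (by rw [minSmoothness_of_isRCLikeNormedField]; exact WithTop.coe_le_coe.2 le_top)

omit [IsManifold I ∞ M] [IsManifold I' ∞ M'] in
lemma mpullback_mem_moduleSpan [CompleteSpace E] (hφ : IsLocalDiffeo I I' φ)
    {U : TopologicalSpace.Opens M} {U' : TopologicalSpace.Opens M'}
    (hU : ∀ q ∈ U, q ∈ φ.source ∧ φ q ∈ U') {S : Set (RawVectorField I M)}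
    {S' : Set (RawVectorField I' M')}
    (hS : ∀ Y ∈ S', ∃ Z ∈ S, ∀ q ∈ U, VectorField.mpullback I I' φ Y q = Z q)
    {X : RawVectorField I' M'} (hX : X ∈ moduleSpan U' S') :
    VectorField.mpullback I I' φ X ∈ moduleSpan U S := by
  obtain ⟨k, a, Y, ha, hY, hX⟩ := hX
  choose Z hZS hZ using fun j => hS (Y j) (hY j)
  refine ⟨k, fun j q => a j (φ q), Z, fun j => ?_, hZS, fun q hq => ?_⟩
  · exact (ha j).comp (hφ.smooth.mono fun q hq => (hU q hq).1) fun q hq => (hU q hq).2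
  · rw [VectorField.mpullback_apply, hX _ (hU q hq).2, map_sum]
    refine Finset.sum_congr rfl fun j _ => ?_
    rw [map_smul, ← VectorField.mpullback_apply, hZ j q hq]

lemma mpullback_mem_derivedModule [CompleteSpace E] [CompleteSpace E']
    (hφ : IsLocalDiffeo I I' φ) {D : PlaneField I M} {D' : PlaneField I' M'}
    (hD : IsPullback φ D D') {U : TopologicalSpace.Opens M} {U' : TopologicalSpace.Opens M'}
    (hU : ∀ q ∈ U, q ∈ φ.source ∧ φ q ∈ U') {i : ℕ} {X : RawVectorField I' M'}
    (hX : X ∈ D'.derivedModule U' i) :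
    VectorField.mpullback I I' φ X ∈ D.derivedModule U i := by
  induction i generalizing X with
  | zero =>
    refine ⟨hφ.isSmoothOn_mpullback hU hX.1, fun q hq => ?_⟩
    rw [hD q (hU q hq).1, Submodule.mem_comap, ContinuousLinearMap.coe_coe,
      hφ.mfderiv_mpullback (hU q hq).1]
    exact hX.2 _ (hU q hq).2
  | succ i ih =>
    refine hφ.mpullback_mem_moduleSpan hU ?_ hX
    rintro Y (hY | ⟨A, hA, B, hB, rfl⟩)
    · exact ⟨_, Or.inl (ih hY), fun _ _ => rfl⟩
    · exact ⟨_, Or.inr ⟨_, ih hA, _, ih hB, rfl⟩, fun q hq =>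
        hφ.mpullback_mlieBracket (derivedModule_isSmoothOn D' hA) (derivedModule_isSmoothOn D' hB)
          (hU q hq).1 (hU q hq).2⟩

lemma mpullback_mem_lieModule [CompleteSpace E] [CompleteSpace E']
    (hφ : IsLocalDiffeo I I' φ) {D : PlaneField I M} {D' : PlaneField I' M'}
    (hD : IsPullback φ D D') {U : TopologicalSpace.Opens M} {U' : TopologicalSpace.Opens M'}
    (hU : ∀ q ∈ U, q ∈ φ.source ∧ φ q ∈ U') {i : ℕ} {X : RawVectorField I' M'}
    (hX : X ∈ D'.lieModule U' i) :
    VectorField.mpullback I I' φ X ∈ D.lieModule U i := by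
  induction i generalizing X with
  | zero => exact hφ.mpullback_mem_derivedModule hD hU (i := 0) hX
  | succ i ih =>
    refine hφ.mpullback_mem_moduleSpan hU ?_ hX
    rintro Y (hY | ⟨A, hA, B, hB, rfl⟩)
    · exact ⟨_, Or.inl (ih hY), fun _ _ => rfl⟩
    · exact ⟨_, Or.inr ⟨_, hφ.mpullback_mem_derivedModule hD hU (i := 0) hA, _, ih hB, rfl⟩,
        fun q hq => hφ.mpullback_mlieBracket hA.1
          (derivedModule_isSmoothOn D' (lieModule_subset_derivedModule D' U' i hB))
          (hU q hq).1 (hU q hq).2⟩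

/-- The open set of points of the source of `φ` that are mapped into `U'`. -/
def preimageOpens (φ : OpenPartialHomeomorph M M') (U' : TopologicalSpace.Opens M') :
    TopologicalSpace.Opens M :=
  ⟨φ.source ∩ φ ⁻¹' U', φ.isOpen_inter_preimage U'.isOpen⟩

lemma comap_derivedFlag_le [CompleteSpace E] [CompleteSpace E']
    (hφ : IsLocalDiffeo I I' φ) {D : PlaneField I M} {D' : PlaneField I' M'}
    (hD : IsPullback φ D D') (i : ℕ) {q : M} (hq : q ∈ φ.source) :
    (D'.derivedFlag i (φ q)).comap (mfderiv I I' φ q).toLinearMap ≤ D.derivedFlag i q := by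
  intro v hv
  have key : ∀ w ∈ D'.derivedFlag i (φ q),
      (mfderiv I I' φ q).inverse w ∈ D.derivedFlag i q := by
    intro w hw
    refine Submodule.span_le (p := (D.derivedFlag i q).comap
      (mfderiv I I' φ q).inverse.toLinearMap).2 ?_ hw
    rintro w ⟨U', hqU', X, hX, rfl⟩
    exact apply_mem_derivedFlag D (U := preimageOpens φ U') ⟨hq, hqU'⟩
      (hφ.mpullback_mem_derivedModule hD (fun q hq => hq) hX)
  have := key _ hv
  obtain ⟨e, he⟩ := hφ.isInvertible_mfderiv hq
  rw [← he, ContinuousLinearMap.inverse_equiv] at this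
  simpa using this

lemma comap_lieFlag_le [CompleteSpace E] [CompleteSpace E']
    (hφ : IsLocalDiffeo I I' φ) {D : PlaneField I M} {D' : PlaneField I' M'}
    (hD : IsPullback φ D D') (i : ℕ) {q : M} (hq : q ∈ φ.source) :
    (D'.lieFlag i (φ q)).comap (mfderiv I I' φ q).toLinearMap ≤ D.lieFlag i q := by
  intro v hv
  have key : ∀ w ∈ D'.lieFlag i (φ q),
      (mfderiv I I' φ q).inverse w ∈ D.lieFlag i q := by
    intro w hw
    refine Submodule.span_le (p := (D.lieFlag i q).comap
      (mfderiv I I' φ q).inverse.toLinearMap).2 ?_ hw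
    rintro w ⟨U', hqU', X, hX, rfl⟩
    exact apply_mem_lieFlag D (U := preimageOpens φ U') ⟨hq, hqU'⟩
      (hφ.mpullback_mem_lieModule hD (fun q hq => hq) hX)
  have := key _ hv
  obtain ⟨e, he⟩ := hφ.isInvertible_mfderiv hq
  rw [← he, ContinuousLinearMap.inverse_equiv] at this
  simpa using this

-- Each inclusion between pulled-back plane fields is proved for all local diffeomorphisms; this
-- turns the one for the inverse of φ into the opposite inclusion for φ.
omit [IsManifold I ∞ M] [IsManifold I' ∞ M'] in
lemma le_comap_of_symm (hφ : IsLocalDiffeo I I' φ) {D : PlaneField I M} {D' : PlaneField I' M'}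
    (h : ∀ y ∈ φ.target, (D (φ.symm y)).comap (mfderiv I' I φ.symm y).toLinearMap ≤ D' y)
    {q : M} (hq : q ∈ φ.source) :
    D q ≤ (D' (φ q)).comap (mfderiv I I' φ q).toLinearMap := by
  intro v hv
  refine h (φ q) (φ.map_source hq) ?_
  have h1 : mfderiv I' I φ.symm (φ q) (mfderiv I I' φ q v) = v :=
    DFunLike.congr_fun (hφ.mdifferentiable.symm_comp_deriv hq) v
  change mfderiv I' I φ.symm (φ q) (mfderiv I I' φ q v) ∈ D (φ.symm (φ q))
  rw [h1]
  exact (mem_congr D (φ.left_inv hq) v).2 hv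

omit [IsManifold I ∞ M] [IsManifold I' ∞ M'] in
lemma isPullback_symm (hφ : IsLocalDiffeo I I' φ) {D : PlaneField I M} {D' : PlaneField I' M'}
    (hD : IsPullback φ D D') : IsPullback φ.symm D' D := by
  intro y hy
  refine le_antisymm (hφ.symm.le_comap_of_symm (fun q hq => (hD q hq).ge) hy) ?_
  intro w hw
  have hs : φ.symm y ∈ φ.source := φ.map_target hy
  rw [Submodule.mem_comap, hD _ hs] at hw
  have h1 : mfderiv I I' φ (φ.symm y) (mfderiv I' I φ.symm y w) = w :=
    DFunLike.congr_fun (hφ.mdifferentiable.comp_symm_deriv hy) w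
  change mfderiv I I' φ (φ.symm y) (mfderiv I' I φ.symm y w) ∈ D' (φ (φ.symm y)) at hw
  rw [h1] at hw
  exact (mem_congr D' (φ.right_inv hy) w).1 hw

lemma isPullback_derivedFlag [CompleteSpace E] [CompleteSpace E']
    (hφ : IsLocalDiffeo I I' φ) {D : PlaneField I M} {D' : PlaneField I' M'}
    (hD : IsPullback φ D D') (i : ℕ) : IsPullback φ (D.derivedFlag i) (D'.derivedFlag i) :=
  fun _ hq => le_antisymm (hφ.le_comap_of_symm (fun _ hy =>
    hφ.symm.comap_derivedFlag_le (hφ.isPullback_symm hD) i hy) hq)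
    (hφ.comap_derivedFlag_le hD i hq)

lemma isPullback_lieFlag [CompleteSpace E] [CompleteSpace E']
    (hφ : IsLocalDiffeo I I' φ) {D : PlaneField I M} {D' : PlaneField I' M'}
    (hD : IsPullback φ D D') (i : ℕ) : IsPullback φ (D.lieFlag i) (D'.lieFlag i) :=
  fun _ hq => le_antisymm (hφ.le_comap_of_symm (fun _ hy =>
    hφ.symm.comap_lieFlag_le (hφ.isPullback_symm hD) i hy) hq)
    (hφ.comap_lieFlag_le hD i hq)

omit [IsManifold I ∞ M] [IsManifold I' ∞ M'] in
lemma finrank_eq (hφ : IsLocalDiffeo I I' φ) {D : PlaneField I M} {D' : PlaneField I' M'}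
    (hD : IsPullback φ D D') {q : M} (hq : q ∈ φ.source) :
    Module.finrank ℝ (D q) = Module.finrank ℝ (D' (φ q)) := by
  let e := (hφ.mdifferentiable.mfderiv hq).toLinearEquiv
  have h1 : (D q).map e.toLinearMap = D' (φ q) := by
    rw [hD q hq]
    exact Submodule.map_comap_eq_of_surjective e.surjective _
  rw [← h1]
  exact (LinearEquiv.finrank_map_eq e (D q)).symm

end IsLocalDiffeo

/-- Near `p`, the plane field `F` contains an involutive subdistribution of corank one. -/
def ContainsInvolutiveCorankOneAt (F : PlaneField I M) (p : M) : Prop :=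
  ∃ U : TopologicalSpace.Opens M, p ∈ U ∧ ∃ (L : PlaneField I M) (k : ℕ),
    L.IsDistributionOn k U ∧ L.IsInvolutiveOn U ∧
    ∀ q ∈ U, L q ≤ F q ∧ Module.finrank ℝ (F q) = k + 1

lemma IsDistributionOn.isPullback [CompleteSpace E] (hφ : IsLocalDiffeo I I' φ)
    {D : PlaneField I M} {D' : PlaneField I' M'} (hD : IsPullback φ D D') {k : ℕ}
    {U' : TopologicalSpace.Opens M'} (h : D'.IsDistributionOn k U') :
    D.IsDistributionOn k (IsLocalDiffeo.preimageOpens φ U') := by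
  rintro p ⟨hp, hpU'⟩
  obtain ⟨V', hpV', hV'U', f, hf, hfs⟩ := h (φ p) hpU'
  refine ⟨IsLocalDiffeo.preimageOpens φ V', ⟨hp, hpV'⟩, fun q hq => ⟨hq.1, hV'U' hq.2⟩,
    fun j => VectorField.mpullback I I' φ (f j),
    fun j => hφ.isSmoothOn_mpullback (fun q hq => hq) (hf j), ?_⟩
  rintro q ⟨hq, hqV'⟩
  obtain ⟨hli, hsp⟩ := hfs (φ q) hqV'
  let e := (hφ.mdifferentiable.mfderiv hq).toLinearEquiv
  have he : ∀ j, VectorField.mpullback I I' φ (f j) q = e.symm (f j (φ q)) := by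
    intro j
    rw [hφ.mpullback_eq_iff hq]
    exact (e.apply_symm_apply _).symm
  simp only [he]
  refine ⟨hli.map' e.symm.toLinearMap e.symm.ker, ?_⟩
  rw [hD q hq, hsp]
  have h1 : (Submodule.span ℝ (Set.range fun j => f j (φ q))).comap e.toLinearMap =
      (Submodule.span ℝ (Set.range fun j => f j (φ q))).map e.symm.toLinearMap :=
    Submodule.comap_equiv_eq_map_symm e _
  refine h1.trans ?_
  rw [Submodule.map_span, ← Set.range_comp]
  rfl

lemma ContainsInvolutiveCorankOneAt.isPullback [CompleteSpace E] [CompleteSpace E']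
    (hφ : IsLocalDiffeo I I' φ) {F : PlaneField I M} {F' : PlaneField I' M'}
    (hF : IsPullback φ F F') {p : M} (hp : p ∈ φ.source)
    (h : F'.ContainsInvolutiveCorankOneAt (φ p)) : F.ContainsInvolutiveCorankOneAt p := by
  obtain ⟨U', hpU', L', k, hdist, hinv, hL'⟩ := h
  let L : PlaneField I M := fun q => (L' (φ q)).comap (mfderiv I I' φ q).toLinearMap
  have hL : IsPullback φ L L' := fun q _ => rfl
  refine ⟨IsLocalDiffeo.preimageOpens φ U', ⟨hp, hpU'⟩, L, k, hdist.isPullback hφ hL, ?_, ?_⟩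
  · intro V hV
    -- X is transported to the target, where involutivity is known, and pulled back again. The
    -- double pullback agrees with X only on V, which suffices because these modules depend only on
    -- values over V.
    refine Set.Subset.antisymm (fun X hX => ?_) (derivedModule_subset_succ L V 0)
    let V' := IsLocalDiffeo.preimageOpens φ.symm V
    have hV'U' : V' ≤ U' := by
      rintro y ⟨hy, hyV⟩
      have := (hV hyV).2
      rwa [Set.mem_preimage, φ.right_inv hy] at this
    have h1 := hφ.symm.mpullback_mem_derivedModule (hφ.isPullback_symm hL)
      (U := V') (fun y hy => hy) hX
    rw [hinv V' hV'U'] at h1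
    have h2 : ∀ q ∈ V, q ∈ φ.source ∧ φ q ∈ V' := by
      intro q hq
      have hqs := (hV hq).1
      refine ⟨hqs, φ.map_source hqs, ?_⟩
      rwa [Set.mem_preimage, φ.left_inv hqs]
    have h3 := hφ.mpullback_mem_derivedModule hL h2 h1
    refine derivedModule_congr L h3 fun q hq => ?_
    obtain ⟨hqs, hqV'⟩ := h2 q hq
    symm
    rw [hφ.mpullback_eq_iff hqs, hφ.symm.mpullback_eq_iff hqV'.1]
    have h4 : mfderiv I' I φ.symm (φ q) (mfderiv I I' φ q (X q)) = X q :=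
      DFunLike.congr_fun (hφ.mdifferentiable.symm_comp_deriv hqs) (X q)
    refine Eq.trans ?_ h4.symm
    have : ∀ q', q' = q → (X q' : E) = X q := by rintro q' rfl; rfl
    exact this _ (φ.left_inv hqs)
  · rintro q ⟨hq, hqU'⟩
    refine ⟨?_, ?_⟩
    · rw [hF q hq]
      exact Submodule.comap_mono (hL' _ hqU').1
    · rw [hφ.finrank_eq hF hq]
      exact (hL' _ hqU').2

end Pullback

end PlaneField

/-! ### Brackets in a vector space and constant distributions. -/

section VectorSpace

variable {E : Type*} [NormedAddCommGroup E] [NormedSpace ℝ E]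

lemma PlaneField.isSmoothOn_iff {X : RawVectorField 𝓘(ℝ, E) E} {U : Set E} :
    PlaneField.IsSmoothOn X U ↔ ContDiffOn ℝ ∞ (fun p => (X p : E)) U :=
  contMDiffOn_vectorSpace_iff_contDiffOn

lemma mlieBracket_vectorSpace_eq (X Y : RawVectorField 𝓘(ℝ, E) E) :
    VectorField.mlieBracket 𝓘(ℝ, E) X Y = VectorField.lieBracket ℝ X Y := by
  rw [← VectorField.mlieBracketWithin_univ, VectorField.mlieBracketWithin_eq_lieBracketWithin]
  exact VectorField.lieBracketWithin_univ

/-- If the form `dx - y dz` annihilates the fields `A` and `B`, its value on the bracket `[A, B]`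
is `(dz ∧ dy) (B, A)`. -/
lemma contactForm_lieBracket {A B : E → E} {x y z : E → ℝ} {q : E}
    (hA : DifferentiableAt ℝ A q) (hB : DifferentiableAt ℝ B q) (hx : ContDiffAt ℝ 2 x q)
    (hy : DifferentiableAt ℝ y q) (hz : ContDiffAt ℝ 2 z q)
    (hAx : ∀ᶠ p in 𝓝 q, fderiv ℝ x p (A p) = fderiv ℝ z p (A p) * y p)
    (hBx : ∀ᶠ p in 𝓝 q, fderiv ℝ x p (B p) = fderiv ℝ z p (B p) * y p) :
    fderiv ℝ x q (VectorField.lieBracket ℝ A B q) -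
        fderiv ℝ z q (VectorField.lieBracket ℝ A B q) * y q =
      fderiv ℝ z q (B q) * fderiv ℝ y q (A q) - fderiv ℝ z q (A q) * fderiv ℝ y q (B q) := by
  have h2 : minSmoothness ℝ 2 ≤ (2 : WithTop ℕ∞) := by simp
  have hdz : DifferentiableAt ℝ (fderiv ℝ z) q :=
    (hz.fderiv_right (m := 1) (by norm_num)).differentiableAt (by simp)
  -- Since [A, B] x = A (B x) - B (A x), and likewise for z, substituting B x = y B z and A x = y A
  -- z near q leaves only the terms in which y is differentiated.
  rw [VectorField.fderiv_apply_lieBracket hx h2 hB hA,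
    VectorField.fderiv_apply_lieBracket hz h2 hB hA,
    Filter.EventuallyEq.fderiv_eq (hBx : _ =ᶠ[𝓝 q] _),
    Filter.EventuallyEq.fderiv_eq (hAx : _ =ᶠ[𝓝 q] _),
    fderiv_fun_mul (hdz.clm_apply hB) hy, fderiv_fun_mul (hdz.clm_apply hA) hy]
  simp only [_root_.add_apply, _root_.smul_apply, smul_eq_mul]
  ring

namespace PlaneField

variable [FiniteDimensional ℝ E]

lemma isDistributionOn_const (W : Submodule ℝ E) (U : TopologicalSpace.Opens E) :
    IsDistributionOn (I := 𝓘(ℝ, E)) (M := E) (fun _ => W) (Module.finrank ℝ W) U := by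
  intro p hp
  let b := Module.finBasis ℝ W
  refine ⟨U, hp, le_rfl, fun j _ => (b j : E), fun j => isSmoothOn_iff.2 contDiffOn_const,
    fun q _ => ⟨?_, ?_⟩⟩
  · exact b.linearIndependent.map' W.subtype W.ker_subtype
  · have h := congrArg (Submodule.map W.subtype) b.span_eq
    rw [Submodule.map_span, ← Set.range_comp, Submodule.map_subtype_top] at h
    exact h.symm

/-- Composing Y with the projection onto a complement of W gives a map that vanishes near p.
Brackets of W-valued fields are differences of such derivatives, so constant distributions are
involutive. -/
lemma fderiv_mem_of_eventually_mem (W : Submodule ℝ E) {Y : E → E} {p : E}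
    (hY : DifferentiableAt ℝ Y p) (h : ∀ᶠ q in 𝓝 p, Y q ∈ W) (v : E) : fderiv ℝ Y p v ∈ W := by
  obtain ⟨P, hP⟩ := W.exists_isCompl
  let π : E →L[ℝ] P := LinearMap.toContinuousLinearMap (P.projectionOnto W hP.symm)
  have hπ : ∀ w, π w = 0 ↔ w ∈ W := fun w => Submodule.projectionOnto_apply_eq_zero_iff hP.symm
  have h1 : HasFDerivAt (fun q => π (Y q)) (π.comp (fderiv ℝ Y p)) p :=
    π.hasFDerivAt.comp p hY.hasFDerivAt
  have h2 : HasFDerivAt (fun q => π (Y q)) (0 : E →L[ℝ] P) p :=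
    (hasFDerivAt_const (0 : P) p).congr_of_eventuallyEq (h.mono fun q hq => (hπ _).2 hq)
  exact (hπ _).1 (DFunLike.congr_fun (h1.unique h2) v)

lemma isInvolutiveOn_const (W : Submodule ℝ E) (U : TopologicalSpace.Opens E) :
    IsInvolutiveOn (I := 𝓘(ℝ, E)) (M := E) (fun _ => W) U := by
  intro V _
  refine Set.Subset.antisymm (fun X hX => ⟨derivedModule_isSmoothOn _ hX, fun p hp => ?_⟩)
    (derivedModule_subset_succ _ V 0)
  obtain ⟨k, a, Y, ha, hY, hX⟩ := hX
  rw [hX p hp]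
  refine Submodule.sum_mem _ fun j _ => Submodule.smul_mem _ _ ?_
  rcases hY j with hY | ⟨A, hA, B, hB, hAB⟩
  · exact hY.2 p hp
  · rw [hAB, mlieBracket_vectorSpace_eq]
    have hn := V.isOpen.mem_nhds hp
    refine Submodule.sub_mem _ ?_ ?_
    · exact fderiv_mem_of_eventually_mem W
        (((isSmoothOn_iff.1 hB.1).contDiffAt hn).differentiableAt (by simp))
        (by filter_upwards [hn] with q hq using hB.2 q hq) _
    · exact fderiv_mem_of_eventually_mem W
        (((isSmoothOn_iff.1 hA.1).contDiffAt hn).differentiableAt (by simp))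
        (by filter_upwards [hn] with q hq using hA.2 q hq) _

end PlaneField

end VectorSpace

/-! ### The flags of the canonical contact system. -/

namespace JetSpace

open PlaneField

variable {n m : ℕ}

/-- The values at `z` of the contact forms `dx_j^l - x_j^{l+1} dx_0^0` with `l < n - k`. -/
def contactForms (n m k : ℕ) (z : JetSpace n m) :
    JetSpace n m →ₗ[ℝ] (Fin (n - k) → Fin m → ℝ) where
  toFun v := fun l j => v.2 ⟨l, by omega⟩ j - v.1 * z.2 ⟨l + 1, by omega⟩ j
  map_add' v w := by ext l j; simp; ring
  map_smul' c v := by ext l j; simp; ring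

/-- The common kernel of the contact forms `dx_j^l - x_j^{l+1} dx_0^0` with `l < n - k`. -/
def contactFlag (n m k : ℕ) (z : JetSpace n m) : Submodule ℝ (JetSpace n m) :=
  LinearMap.ker (contactForms n m k z)

lemma mem_contactFlag {k : ℕ} {z v : JetSpace n m} :
    v ∈ contactFlag n m k z ↔ ∀ (l : ℕ) (h : l + k < n) (j : Fin m),
      v.2 ⟨l, by omega⟩ j = v.1 * z.2 ⟨l + 1, by omega⟩ j := by
  rw [contactFlag, LinearMap.mem_ker]
  constructor
  · intro h l hl j
    exact sub_eq_zero.1 (congrFun (congrFun h ⟨l, by omega⟩) j)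
  · intro h
    ext l j
    exact sub_eq_zero.2 (h l (by omega) j)

lemma finrank_jetSpace : Module.finrank ℝ (JetSpace n m) = (n + 1) * m + 1 := by
  rw [Module.finrank_prod, Module.finrank_self, Module.finrank_pi_fintype]
  simp [add_comm]

lemma finrank_contactFlag {k : ℕ} (hk : k ≤ n) (z : JetSpace n m) :
    Module.finrank ℝ (contactFlag n m k z) = (k + 1) * m + 1 := by
  have hsurj : LinearMap.range (contactForms n m k z) = ⊤ := by
    refine LinearMap.range_eq_top.2 fun w => ?_
    refine ⟨(0, fun i j => if h : (i : ℕ) < n - k then w ⟨i, h⟩ j else 0), ?_⟩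
    ext l j
    simp [contactForms]
  have h1 := LinearMap.finrank_range_add_finrank_ker (contactForms n m k z)
  rw [hsurj, finrank_top, finrank_jetSpace, Module.finrank_pi_fintype] at h1
  obtain ⟨d, rfl⟩ := Nat.exists_eq_add_of_le hk
  simp only [Module.finrank_fintype_fun_eq_card, Fintype.card_fin, Finset.sum_const,
    Finset.card_univ, smul_eq_mul, Nat.add_sub_cancel_left] at h1
  change d * m + Module.finrank ℝ (contactFlag (k + d) m k z) = _ at h1
  nlinarith

/-- The constant field `∂ / ∂ x_j^l`. -/
def coordField (n m : ℕ) (l : Fin (n + 1)) (j : Fin m) : JetSpace n m :=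
  (0, Pi.single l (Pi.single j 1))

lemma eq_sum_coordField (v : Fin (n + 1) → Fin m → ℝ) :
    ((0, v) : JetSpace n m) = ∑ l, ∑ j, v l j • coordField n m l j := by
  refine Prod.ext ?_ ?_
  · simp [coordField, Prod.fst_sum]
  · ext a b
    simp only [coordField, Prod.snd_sum, Prod.smul_mk, Finset.sum_apply, Pi.smul_apply, smul_eq_mul]
    rw [Finset.sum_eq_single a (fun l _ hl => by simp [Pi.single_eq_of_ne hl.symm]) (by simp),
      Finset.sum_eq_single b (fun j _ hj => by simp [Pi.single_eq_of_ne hj.symm]) (by simp)]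
    simp

lemma totalDerivative_mem_contactFlag (k : ℕ) (z : JetSpace n m) :
    (totalDerivative n m z : JetSpace n m) ∈ contactFlag n m k z := by
  refine mem_contactFlag.2 fun l h j => ?_
  simp [totalDerivative, show l < n by omega]

/-- An upper bound for subspaces containing the contact flag. -/
lemma contactFlag_le {k : ℕ} {z : JetSpace n m} {S : Submodule ℝ (JetSpace n m)}
    (hT : (totalDerivative n m z : JetSpace n m) ∈ S)
    (hS : ∀ (l : Fin (n + 1)) (j : Fin m), n ≤ l + k → coordField n m l j ∈ S) :
    contactFlag n m k z ≤ S := by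
  intro v hv
  let T : JetSpace n m := totalDerivative n m z
  have hT1 : T.1 = 1 := rfl
  have h1 : v = v.1 • T + (0, (v - v.1 • T).2) := by
    refine Prod.ext ?_ ?_
    · simp [hT1]
    · simp
  rw [h1, eq_sum_coordField]
  refine S.add_mem (S.smul_mem _ hT) (S.sum_mem fun l _ => S.sum_mem fun j _ => ?_)
  by_cases hl : n ≤ l + k
  · exact S.smul_mem _ (hS l j hl)
  · have h2 := Submodule.sub_mem _ hv (Submodule.smul_mem _ v.1
      (totalDerivative_mem_contactFlag k z))
    have h3 := mem_contactFlag.1 h2 l (by omega) j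
    have h4 : (v - v.1 • T).1 = 0 := by simp [hT1]
    have h5 : (v - v.1 • T).2 l j = 0 := by
      refine h3.trans ?_
      change (v - v.1 • T).1 * _ = 0
      rw [h4, zero_mul]
    rw [h5, zero_smul]
    exact S.zero_mem

lemma totalDerivative_mem_contactSystem (z : JetSpace n m) :
    totalDerivative n m z ∈ contactSystem n m z :=
  Submodule.subset_span (Or.inr rfl)

lemma verticalField_mem_contactSystem (j : Fin m) (z : JetSpace n m) :
    verticalField n m j z ∈ contactSystem n m z :=
  Submodule.subset_span (Or.inl ⟨j, rfl⟩)

lemma contactSystem_eq (z : JetSpace n m) : contactSystem n m z = contactFlag n m 0 z := by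
  refine le_antisymm (Submodule.span_le.2 ?_) (contactFlag_le ?_ ?_)
  · rintro v (⟨j, rfl⟩ | rfl)
    · refine mem_contactFlag.2 fun l h i => ?_
      have : (⟨l, by omega⟩ : Fin (n + 1)) ≠ Fin.last n := by
        intro h'; have := congrArg Fin.val h'; simp at this; omega
      simp [verticalField, Pi.single_eq_of_ne this]
    · exact totalDerivative_mem_contactFlag 0 z
  · exact totalDerivative_mem_contactSystem z
  · intro l j hl
    have : l = Fin.last n := by ext; simp; omega
    subst this
    exact verticalField_mem_contactSystem j z

/-- The coordinate `x_j^l`. -/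
noncomputable def coordL (n m : ℕ) (l : Fin (n + 1)) (j : Fin m) : JetSpace n m →L[ℝ] ℝ :=
  (ContinuousLinearMap.proj j).comp
    ((ContinuousLinearMap.proj l).comp (ContinuousLinearMap.snd ℝ ℝ (Fin (n + 1) → Fin m → ℝ)))

/-- If A and B are killed by the contact forms of orders l and l + 1, then `contactForm_lieBracket`
shows that the form of order l kills [A, B]: substituting for the derivatives of x_j^{l+1} makes the
two products cancel. So each bracket loses at most one order. -/
lemma derivedModule_contactSystem {U : TopologicalSpace.Opens (JetSpace n m)} {k : ℕ}
    {X : RawVectorField 𝓘(ℝ, JetSpace n m) (JetSpace n m)}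
    (hX : X ∈ (contactSystem n m).derivedModule U k) {z : JetSpace n m} (hz : z ∈ U) :
    X z ∈ contactFlag n m k z := by
  induction k generalizing X z with
  | zero =>
    rw [← contactSystem_eq]
    exact hX.2 z hz
  | succ k ih =>
    obtain ⟨r, a, Y, ha, hY, hX⟩ := hX
    rw [hX z hz]
    refine Submodule.sum_mem _ fun i _ => Submodule.smul_mem _ _ ?_
    rcases hY i with hY | ⟨A, hA, B, hB, hAB⟩
    · exact mem_contactFlag.2 fun l h j => mem_contactFlag.1 (ih hY hz) l (by omega) j
    · refine mem_contactFlag.2 fun l h j => ?_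
      rw [hAB, mlieBracket_vectorSpace_eq]
      have hn := U.isOpen.mem_nhds hz
      have hd : ∀ C ∈ (contactSystem n m).derivedModule U k,
          DifferentiableAt ℝ (fun p => (C p : JetSpace n m)) z := fun C hC =>
        ((isSmoothOn_iff.1 (derivedModule_isSmoothOn _ hC)).contDiffAt hn).differentiableAt
          (by simp)
      have hc : ∀ C ∈ (contactSystem n m).derivedModule U k, ∀ (l : ℕ) (h : l + k < n),
          ∀ p ∈ U, fderiv ℝ (coordL n m ⟨l, by omega⟩ j) p (C p) =
            fderiv ℝ (ContinuousLinearMap.fst ℝ ℝ (Fin (n + 1) → Fin m → ℝ)) p (C p) *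
              coordL n m ⟨l + 1, by omega⟩ j p := by
        intro C hC l h p hp
        rw [ContinuousLinearMap.fderiv, ContinuousLinearMap.fderiv]
        exact mem_contactFlag.1 (ih hC hp) l h j
      have key := contactForm_lieBracket (A := A) (B := B) (q := z)
        (x := coordL n m ⟨l, by omega⟩ j) (y := coordL n m ⟨l + 1, by omega⟩ j)
        (z := ContinuousLinearMap.fst ℝ ℝ (Fin (n + 1) → Fin m → ℝ))
        (hd A hA) (hd B hB) (coordL n m _ j).contDiff.contDiffAt
        (coordL n m _ j).differentiableAt (ContinuousLinearMap.contDiff _).contDiffAt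
        (by filter_upwards [hn] with p hp using hc A hA l (by omega) p hp)
        (by filter_upwards [hn] with p hp using hc B hB l (by omega) p hp)
      rw [hc A hA (l + 1) (by omega) z hz, hc B hB (l + 1) (by omega) z hz] at key
      rw [ContinuousLinearMap.fderiv, ContinuousLinearMap.fderiv] at key
      refine sub_eq_zero.1 (key.trans ?_)
      ring

/-- The linear part of the total derivative. -/
def shiftₗ (n m : ℕ) : JetSpace n m →ₗ[ℝ] JetSpace n m where
  toFun v := (0, fun i j => if h : (i : ℕ) + 1 < n + 1 then v.2 ⟨i + 1, h⟩ j else 0)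
  map_add' v w := by
    refine Prod.ext (by simp) ?_
    ext i j; simp only [Prod.snd_add, Pi.add_apply]; split_ifs <;> simp
  map_smul' c v := by
    refine Prod.ext (by simp) ?_
    ext i j; simp only [Prod.smul_snd, Pi.smul_apply, RingHom.id_apply]; split_ifs <;> simp

lemma totalDerivative_eq (z : JetSpace n m) :
    (totalDerivative n m z : JetSpace n m) =
      ((1, 0) : JetSpace n m) + LinearMap.toContinuousLinearMap (shiftₗ n m) z := by
  refine Prod.ext ?_ ?_
  · change (1 : ℝ) = 1 + 0
    simp
  · change _ = (0 : Fin (n + 1) → Fin m → ℝ) + _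
    rw [zero_add]
    rfl

lemma hasFDerivAt_totalDerivative (z : JetSpace n m) :
    HasFDerivAt (fun z => (totalDerivative n m z : JetSpace n m))
      (LinearMap.toContinuousLinearMap (shiftₗ n m)) z := by
  simp only [totalDerivative_eq]
  exact (ContinuousLinearMap.hasFDerivAt _).const_add _

lemma shiftₗ_coordField {l : ℕ} (h : l + 1 < n + 1) (j : Fin m) :
    shiftₗ n m (coordField n m ⟨l + 1, h⟩ j) = coordField n m ⟨l, by omega⟩ j := by
  refine Prod.ext rfl ?_
  ext i a
  simp only [shiftₗ, coordField, LinearMap.coe_mk, AddHom.coe_mk]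
  by_cases hi : (i : ℕ) = l
  · subst hi
    simp [h]
  · have h1 : i ≠ ⟨l, by omega⟩ := fun h' => hi (congrArg Fin.val h')
    split_ifs with h2
    · have h3 : (⟨i + 1, h2⟩ : Fin (n + 1)) ≠ ⟨l + 1, h⟩ := by
        intro h'; have := congrArg Fin.val h'; simp at this; omega
      simp [Pi.single_eq_of_ne h1, Pi.single_eq_of_ne h3]
    · simp [Pi.single_eq_of_ne h1]

lemma totalDerivative_mem_sectionsOn (U : TopologicalSpace.Opens (JetSpace n m)) :
    totalDerivative n m ∈ (contactSystem n m).sectionsOn U := by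
  refine ⟨isSmoothOn_iff.2 ?_, fun z _ => ?_⟩
  · simp only [totalDerivative_eq]
    exact (contDiff_const.add (ContinuousLinearMap.contDiff _)).contDiffOn
  · rw [contactSystem_eq]
    exact totalDerivative_mem_contactFlag 0 z

/-- The bracket of the total derivative with ∂/∂x_j^{l+1} is -∂/∂x_j^l, so each step of the Lie flag
gains one order; this is the source of the coefficient -1. -/
lemma coordField_mem_lieModule (U : TopologicalSpace.Opens (JetSpace n m)) {k : ℕ}
    {l : Fin (n + 1)} (hl : n ≤ l + k) (j : Fin m) :
    (fun _ => coordField n m l j : RawVectorField 𝓘(ℝ, JetSpace n m) (JetSpace n m)) ∈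
      (contactSystem n m).lieModule U k := by
  induction k generalizing l with
  | zero =>
    have : l = Fin.last n := by ext; simp; omega
    subst this
    exact ⟨isSmoothOn_iff.2 contDiffOn_const, fun z _ => verticalField_mem_contactSystem j z⟩
  | succ k ih =>
    by_cases hl' : n ≤ l + k
    · exact subset_moduleSpan _ _ (Or.inl (ih hl'))
    · have h1 : (l : ℕ) + 1 < n + 1 := by omega
      have h2 := ih (l := ⟨l + 1, h1⟩) (by simp; omega)
      refine ⟨1, fun _ _ => -1, fun _ => _, fun _ => contMDiffOn_const, fun _ => Or.inr
        ⟨_, totalDerivative_mem_sectionsOn U, _, h2, rfl⟩, fun z _ => ?_⟩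
      simp only [Finset.univ_unique, Finset.sum_const, Finset.card_singleton, one_smul]
      have h3 : VectorField.lieBracket ℝ (totalDerivative n m)
          (fun _ => coordField n m ⟨l + 1, h1⟩ j) z = - coordField n m l j := by
        change fderiv ℝ (fun _ : JetSpace n m => coordField n m ⟨l + 1, h1⟩ j) z _ -
          fderiv ℝ (fun z => (totalDerivative n m z : JetSpace n m)) z
            (coordField n m ⟨l + 1, h1⟩ j) = _
        rw [(hasFDerivAt_totalDerivative z).fderiv, fderiv_fun_const]
        simp only [LinearMap.coe_toContinuousLinearMap', shiftₗ_coordField]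
        exact zero_sub _
      have h4 := (congrFun (mlieBracket_vectorSpace_eq _ _) z).trans h3
      have h5 : coordField n m l j = (-1 : ℝ) • (-coordField n m l j) := by simp
      exact h5.trans (congrArg (fun v : JetSpace n m => (-1 : ℝ) • v) h4.symm)

lemma contactFlag_le_lieFlag (k : ℕ) (z : JetSpace n m) :
    contactFlag n m k z ≤ (contactSystem n m).lieFlag k z := by
  refine contactFlag_le ?_ ?_
  · refine apply_mem_lieFlag _ (U := ⊤) trivial (X := totalDerivative n m) ?_
    induction k with
    | zero => exact totalDerivative_mem_sectionsOn ⊤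
    | succ k ih => exact subset_moduleSpan _ _ (Or.inl ih)
  · intro l j hl
    exact apply_mem_lieFlag _ (U := ⊤) trivial (coordField_mem_lieModule ⊤ hl j)

lemma derivedFlag_le_contactFlag (k : ℕ) (z : JetSpace n m) :
    (contactSystem n m).derivedFlag k z ≤ contactFlag n m k z := by
  refine Submodule.span_le.2 ?_
  rintro v ⟨U, hz, X, hX, rfl⟩
  exact derivedModule_contactSystem hX hz

/-- Both flags are squeezed: the contact flag is contained in the Lie flag, which is contained in
the derived flag, which is contained in the contact flag. -/
lemma derivedFlag_contactSystem (k : ℕ) (z : JetSpace n m) :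
    (contactSystem n m).derivedFlag k z = contactFlag n m k z :=
  (derivedFlag_le_contactFlag k z).antisymm
    ((contactFlag_le_lieFlag k z).trans (lieFlag_le_derivedFlag _ k z))

lemma lieFlag_contactSystem (k : ℕ) (z : JetSpace n m) :
    (contactSystem n m).lieFlag k z = contactFlag n m k z :=
  ((lieFlag_le_derivedFlag _ k z).trans (derivedFlag_le_contactFlag k z)).antisymm
    (contactFlag_le_lieFlag k z)

/-- The projection whose kernel is spanned by the fields `∂ / ∂ x_j^l` with `n - k ≤ l`. -/
def verticalForms (n m k : ℕ) : JetSpace n m →ₗ[ℝ] ℝ × (Fin (n - k) → Fin m → ℝ) where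
  toFun v := (v.1, fun l j => v.2 ⟨l, by omega⟩ j)
  map_add' _ _ := rfl
  map_smul' _ _ := rfl

lemma finrank_ker_verticalForms {k : ℕ} (hk : k ≤ n) :
    Module.finrank ℝ (LinearMap.ker (verticalForms n m k)) = (k + 1) * m := by
  have hsurj : LinearMap.range (verticalForms n m k) = ⊤ := by
    refine LinearMap.range_eq_top.2 fun w => ?_
    refine ⟨(w.1, fun i j => if h : (i : ℕ) < n - k then w.2 ⟨i, h⟩ j else 0), ?_⟩
    refine Prod.ext rfl ?_
    ext l j
    simp [verticalForms]
  have h1 := LinearMap.finrank_range_add_finrank_ker (verticalForms n m k)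
  rw [hsurj, finrank_top, finrank_jetSpace, Module.finrank_prod, Module.finrank_self,
    Module.finrank_pi_fintype] at h1
  obtain ⟨d, rfl⟩ := Nat.exists_eq_add_of_le hk
  simp only [Module.finrank_fintype_fun_eq_card, Fintype.card_fin, Finset.sum_const,
    Finset.card_univ, smul_eq_mul, Nat.add_sub_cancel_left] at h1
  nlinarith

/-- The span of the fields `∂ / ∂ x_j^l` with `n - k ≤ l`. -/
def verticalFlag (n m k : ℕ) : Submodule ℝ (JetSpace n m) :=
  LinearMap.ker (verticalForms n m k)

lemma verticalFlag_le_contactFlag (k : ℕ) (z : JetSpace n m) :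
    verticalFlag n m k ≤ contactFlag n m k z := by
  intro v hv
  have hv' : verticalForms n m k v = 0 := LinearMap.mem_ker.1 hv
  refine mem_contactFlag.2 fun l h j => ?_
  have h1 : v.1 = 0 := congrArg Prod.fst hv'
  have h2 := congrFun (congrFun (congrArg Prod.snd hv') ⟨l, by omega⟩) j
  rw [h1, zero_mul]
  exact h2

lemma isDistributionOn_verticalFlag {k : ℕ} (hk : k ≤ n)
    (U : TopologicalSpace.Opens (JetSpace n m)) :
    IsDistributionOn (I := 𝓘(ℝ, JetSpace n m)) (M := JetSpace n m) (fun _ => verticalFlag n m k)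
      ((k + 1) * m) U := by
  have h := isDistributionOn_const (verticalFlag n m k) U
  have h2 : Module.finrank ℝ (verticalFlag n m k) = (k + 1) * m := finrank_ker_verticalForms hk
  rwa [h2] at h

lemma containsInvolutiveCorankOneAt_contactSystem {k : ℕ} (hk : k ≤ n) (z : JetSpace n m) :
    ((contactSystem n m).derivedFlag k).ContainsInvolutiveCorankOneAt z := by
  refine ⟨⊤, trivial, fun _ => verticalFlag n m k, (k + 1) * m,
    isDistributionOn_verticalFlag hk _, isInvolutiveOn_const _ _, fun q _ => ?_⟩
  rw [derivedFlag_contactSystem]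
  exact ⟨verticalFlag_le_contactFlag k q, finrank_contactFlag hk q⟩

end JetSpace

/-! ### Necessity: the flags of a distribution equivalent to the contact system. -/

namespace PlaneField

variable {E H : Type*} [NormedAddCommGroup E] [NormedSpace ℝ E] [TopologicalSpace H]
  {I : ModelWithCorners ℝ E H} {M : Type*} [TopologicalSpace M] [ChartedSpace H M]
  [IsManifold I ∞ M]

omit [IsManifold I ∞ M] in
lemma LocallyEquivalentAt.exists_isPullback {E' H' : Type*} [NormedAddCommGroup E']
    [NormedSpace ℝ E'] [TopologicalSpace H'] {I' : ModelWithCorners ℝ E' H'} {M' : Type*}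
    [TopologicalSpace M'] [ChartedSpace H' M'] {D : PlaneField I M} {D' : PlaneField I' M'} {p : M}
    (h : D.LocallyEquivalentAt D' p) :
    ∃ φ : OpenPartialHomeomorph M M', p ∈ φ.source ∧ IsLocalDiffeo I I' φ ∧ IsPullback φ D D' := by
  obtain ⟨φ, hp, h1, h2, h3⟩ := h
  have hφ : IsLocalDiffeo I I' φ := ⟨h1, h2⟩
  refine ⟨φ, hp, hφ, fun q hq => ?_⟩
  rw [← h3 q hq]
  exact (Submodule.comap_map_eq_of_injective (hφ.mdifferentiable.mfderiv_injective hq) _).symm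

omit [IsManifold I ∞ M] in
lemma IsPullback.locallyEquivalentAt {E' H' : Type*} [NormedAddCommGroup E']
    [NormedSpace ℝ E'] [TopologicalSpace H'] {I' : ModelWithCorners ℝ E' H'} {M' : Type*}
    [TopologicalSpace M'] [ChartedSpace H' M'] {D : PlaneField I M} {D' : PlaneField I' M'}
    {φ : OpenPartialHomeomorph M M'} (h : IsPullback φ D D') (hφ : IsLocalDiffeo I I' φ)
    {p : M} (hp : p ∈ φ.source) : D.LocallyEquivalentAt D' p := by
  refine ⟨φ, hp, hφ.smooth, hφ.smooth_symm, fun q hq => ?_⟩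
  rw [h q hq]
  exact Submodule.map_comap_eq_of_surjective (hφ.mdifferentiable.mfderiv_surjective hq) _

lemma flags_of_locallyEquivalentAt_contactSystem [CompleteSpace E] {n m : ℕ} {D : PlaneField I M}
    (h : ∀ p, D.LocallyEquivalentAt (JetSpace.contactSystem n m) p) {i : ℕ} (hi : i ≤ n) :
    ((D.derivedFlag i).HasConstantRank ((i + 1) * m + 1) ∧
      (D.derivedFlag i).ContainsInvolutiveCorankOne) ∧
      (D.lieFlag i).HasConstantRank ((i + 1) * m + 1) := by
  refine ⟨⟨fun p => ?_, fun p => ?_⟩, fun p => ?_⟩ <;>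
    obtain ⟨φ, hp, hφ, hD⟩ := (h p).exists_isPullback
  · rw [hφ.finrank_eq (hφ.isPullback_derivedFlag hD i) hp, JetSpace.derivedFlag_contactSystem]
    exact JetSpace.finrank_contactFlag hi _
  · exact ContainsInvolutiveCorankOneAt.isPullback hφ (hφ.isPullback_derivedFlag hD i) hp
      (JetSpace.containsInvolutiveCorankOneAt_contactSystem hi _)
  · rw [hφ.finrank_eq (hφ.isPullback_lieFlag hD i) hp, JetSpace.lieFlag_contactSystem]
    exact JetSpace.finrank_contactFlag hi _

end PlaneField

/-! ### The derived flag on a normed space. -/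

namespace PlaneField

variable {E : Type*} [NormedAddCommGroup E] [NormedSpace ℝ E]

/-- The fields of the derived flag on a normed space, as plain functions. -/
def fields (D : PlaneField 𝓘(ℝ, E) E) (U : TopologicalSpace.Opens E) (i : ℕ) : Set (E → E) :=
  D.derivedModule U i

/-- The derived flag on a normed space, as a family of plain subspaces. -/
noncomputable def flagAt (D : PlaneField 𝓘(ℝ, E) E) (i : ℕ) (q : E) : Submodule ℝ E :=
  D.derivedFlag i q

variable {D : PlaneField 𝓘(ℝ, E) E} {U V : TopologicalSpace.Opens E} {i j : ℕ} {q : E}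

lemma contDiffOn_of_mem_fields [CompleteSpace E] {X : E → E} (hX : X ∈ D.fields U i) :
    ContDiffOn ℝ ∞ X U :=
  isSmoothOn_iff.1 (derivedModule_isSmoothOn D hX)

lemma contDiffAt_of_mem_fields [CompleteSpace E] {X : E → E} (hX : X ∈ D.fields U i)
    (hq : q ∈ U) : ContDiffAt ℝ ∞ X q :=
  (contDiffOn_of_mem_fields hX).contDiffAt (U.isOpen.mem_nhds hq)

lemma differentiableAt_of_mem_fields [CompleteSpace E] {X : E → E} (hX : X ∈ D.fields U i)
    (hq : q ∈ U) : DifferentiableAt ℝ X q :=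
  (contDiffAt_of_mem_fields hX hq).differentiableAt (by simp)

lemma apply_mem_flagAt {X : E → E} (hX : X ∈ D.fields U i) (hq : q ∈ U) :
    X q ∈ D.flagAt i q :=
  apply_mem_derivedFlag D hq hX

lemma fields_mono_open {X : E → E} (hX : X ∈ D.fields U i) (hVU : V ≤ U) : X ∈ D.fields V i :=
  derivedModule_mono D hVU i hX

lemma fields_mono {X : E → E} (hX : X ∈ D.fields U i) (hij : i ≤ j) : X ∈ D.fields U j := by
  induction hij with
  | refl => exact hX
  | step _ ih => exact derivedModule_subset_succ D U _ ih

lemma flagAt_mono (hij : i ≤ j) : D.flagAt i q ≤ D.flagAt j q := by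
  induction hij with
  | refl => exact le_rfl
  | step _ ih => exact ih.trans (derivedFlag_le_succ D _ q)

lemma flagAt_le {S : Submodule ℝ E}
    (h : ∀ U : TopologicalSpace.Opens E, q ∈ U → U ≤ V → ∀ X ∈ D.fields U i, X q ∈ S)
    (hqV : q ∈ V) : D.flagAt i q ≤ S := by
  refine Submodule.span_le.2 ?_
  rintro v ⟨U, hq, X, hX, rfl⟩
  exact h (U ⊓ V) ⟨hq, hqV⟩ inf_le_right X (fields_mono_open hX inf_le_left)

lemma lieBracket_mem_fields {X Y : E → E} (hX : X ∈ D.fields U i) (hY : Y ∈ D.fields U i) :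
    VectorField.lieBracket ℝ X Y ∈ D.fields U (i + 1) := by
  have h : VectorField.mlieBracket 𝓘(ℝ, E) X Y ∈ D.fields U (i + 1) :=
    mlieBracket_mem_derivedModule D hX hY
  rwa [mlieBracket_vectorSpace_eq (E := E) X Y] at h

lemma apply_mem_of_mem_moduleSpan {T : Set (RawVectorField 𝓘(ℝ, E) E)} {X : E → E}
    (hX : X ∈ moduleSpan (I := 𝓘(ℝ, E)) (M := E) U T)
    (hq : q ∈ U) {S : Submodule ℝ E} (hS : ∀ Y ∈ T, (Y q : E) ∈ S) : X q ∈ S := by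
  obtain ⟨k, a, Y, -, hY, hX⟩ := hX
  have h1 : X q = ∑ j, a j q • (Y j q : E) := hX q hq
  rw [h1]
  exact S.sum_mem fun j _ => S.smul_mem _ (hS _ (hY j))

lemma apply_mem_of_mem_fields_succ {X : E → E} (hX : X ∈ D.fields U (i + 1)) (hq : q ∈ U)
    {S : Submodule ℝ E} (h1 : ∀ Y ∈ D.fields U i, Y q ∈ S)
    (h2 : ∀ A ∈ D.fields U i, ∀ B ∈ D.fields U i, VectorField.lieBracket ℝ A B q ∈ S) :
    X q ∈ S := by
  refine apply_mem_of_mem_moduleSpan hX hq ?_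
  rintro Y (hY | ⟨A, hA, B, hB, rfl⟩)
  · exact h1 Y hY
  · rw [mlieBracket_vectorSpace_eq]
    exact h2 A hA B hB

/-- Upper bounds are all that is needed, so the fields of D_i may be replaced by the larger module
D^(i), on which the contact forms are controlled. -/
lemma lieFlag_succ_le (D : PlaneField 𝓘(ℝ, E) E) (i : ℕ) (q : E) {S : Submodule ℝ E}
    (h1 : ∀ U : TopologicalSpace.Opens E, q ∈ U → ∀ Y ∈ D.fields U i, Y q ∈ S)
    (h2 : ∀ U : TopologicalSpace.Opens E, q ∈ U → ∀ A ∈ D.fields U 0, ∀ B ∈ D.fields U i,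
      VectorField.lieBracket ℝ A B q ∈ S) :
    (D.lieFlag (i + 1) q : Submodule ℝ E) ≤ S := by
  refine Submodule.span_le.2 ?_
  rintro v ⟨U, hq, X, hX, rfl⟩
  refine apply_mem_of_mem_moduleSpan hX hq ?_
  rintro Y (hY | ⟨A, hA, B, hB, rfl⟩)
  · exact h1 U hq Y (lieModule_subset_derivedModule D U i hY)
  · rw [mlieBracket_vectorSpace_eq]
    exact h2 U hq A hA B (lieModule_subset_derivedModule D U i hB)

lemma smul_mem_fields_zero {X : E → E} (hX : X ∈ D.fields U 0) {c : E → ℝ}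
    (hc : ContDiffOn ℝ ∞ c U) : (fun p => c p • X p) ∈ D.fields U 0 :=
  ⟨isSmoothOn_iff.2 (hc.smul (isSmoothOn_iff.1 hX.1)),
    fun p hp => Submodule.smul_mem _ _ (hX.2 p hp)⟩

lemma flagAt_zero {k : ℕ} (hD : D.IsDistributionOn k V) (hq : q ∈ V) :
    D.flagAt 0 q = (D q : Submodule ℝ E) := by
  refine le_antisymm (flagAt_le (V := ⊤) (fun U hq _ X hX => hX.2 q hq) trivial) ?_
  obtain ⟨W, hqW, -, f, hf, hfs⟩ := hD q hq
  rw [(hfs q hqW).2]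
  refine Submodule.span_le.2 ?_
  rintro v ⟨j, rfl⟩
  refine apply_mem_flagAt (U := W) (X := f j) ⟨hf j, fun p hp => ?_⟩ hqW
  have h1 : f j p ∈ Submodule.span ℝ (Set.range fun j => f j p) :=
    Submodule.subset_span ⟨j, rfl⟩
  rwa [← (hfs p hp).2] at h1

lemma exists_field_of_mem_flagAt_zero {k : ℕ} (hD : D.IsDistributionOn k V) (hq : q ∈ V)
    {v : E} (hv : v ∈ D.flagAt 0 q) :
    ∃ U : TopologicalSpace.Opens E, q ∈ U ∧ ∃ X ∈ D.fields U 0, X q = v := by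
  rw [flagAt_zero hD hq] at hv
  obtain ⟨W, hqW, -, f, hf, hfs⟩ := hD q hq
  have hspan := (hfs q hqW).2
  rw [hspan] at hv
  let g : Fin k → E := fun j => f j q
  have hv' : v ∈ Submodule.span ℝ (Set.range g) := hv
  obtain ⟨c, hc⟩ := (Submodule.mem_span_range_iff_exists_fun ℝ).1 hv'
  refine ⟨W, hqW, fun p => ∑ j, c j • f j p, ⟨?_, fun p hp => ?_⟩, hc⟩
  · exact isSmoothOn_iff.2 (ContDiffOn.sum fun j _ =>
      contDiffOn_const.smul (isSmoothOn_iff.1 (hf j)))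
  · rw [(hfs p hp).2]
    exact Submodule.sum_mem _ fun j _ => Submodule.smul_mem _ _ (Submodule.subset_span ⟨j, rfl⟩)

end PlaneField

/-! ### Dimension counts and factorisation of linear maps. -/

section LinearAlgebra

variable {E F : Type*} [AddCommGroup E] [Module ℝ E] [FiniteDimensional ℝ E]
  [AddCommGroup F] [Module ℝ F]

lemma Submodule.exists_eq_add_smul_of_finrank {L K : Submodule ℝ E} (hLK : L ≤ K) {b : E}
    (hb : b ∈ K) (hbL : b ∉ L) (hfin : Module.finrank ℝ K = Module.finrank ℝ L + 1) {v : E}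
    (hv : v ∈ K) : ∃ l ∈ L, ∃ c : ℝ, v = l + c • b := by
  have hle : L ⊔ Submodule.span ℝ {b} ≤ K :=
    sup_le hLK ((Submodule.span_singleton_le_iff_mem _ _).2 hb)
  have hlt : L < L ⊔ Submodule.span ℝ {b} := by
    refine lt_of_le_of_ne le_sup_left fun h => hbL ?_
    rw [h]
    exact Submodule.mem_sup_right (Submodule.mem_span_singleton_self b)
  have h1 := Submodule.finrank_lt_finrank_of_lt hlt
  have heq : L ⊔ Submodule.span ℝ {b} = K :=
    Submodule.eq_of_le_of_finrank_le hle (by omega)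
  rw [← heq] at hv
  obtain ⟨l, hl, w, hw, rfl⟩ := Submodule.mem_sup.1 hv
  obtain ⟨c, rfl⟩ := Submodule.mem_span_singleton.1 hw
  exact ⟨l, hl, c, rfl⟩

lemma Submodule.finrank_map_add_finrank_inf_ker (K : Submodule ℝ E) (f : E →ₗ[ℝ] F) :
    Module.finrank ℝ (K.map f) + Module.finrank ℝ (K ⊓ LinearMap.ker f : Submodule ℝ E) =
      Module.finrank ℝ K := by
  rw [← LinearMap.finrank_range_add_finrank_ker (f.domRestrict K), LinearMap.range_domRestrict]
  congr 1
  have h : K ⊓ LinearMap.ker f = (LinearMap.ker (f.domRestrict K)).map K.subtype := by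
    ext v
    simp [and_comm]
  rw [h, Submodule.finrank_map_subtype_eq K]

omit [FiniteDimensional ℝ E] in
lemma LinearMap.exists_comp_eq_of_ker_le {G : Type*} [AddCommGroup G] [Module ℝ G]
    (f : E →ₗ[ℝ] F) (g : E →ₗ[ℝ] G) (h : LinearMap.ker f ≤ LinearMap.ker g) :
    ∃ μ : F →ₗ[ℝ] G, ∀ v, μ (f v) = g v := by
  let g' : LinearMap.range f →ₗ[ℝ] G :=
    ((LinearMap.ker f).liftQ g h).comp f.quotKerEquivRange.symm.toLinearMap
  obtain ⟨μ, hμ⟩ := LinearMap.exists_extend g'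
  refine ⟨μ, fun v => ?_⟩
  have h1 := DFunLike.congr_fun hμ ⟨f v, v, rfl⟩
  refine Eq.trans h1 ?_
  have h2 := f.quotKerEquivRange_symm_apply_image v (LinearMap.mem_range_self f v)
  exact congrArg ((LinearMap.ker f).liftQ g h) h2

end LinearAlgebra

/-- The derivative of a smooth function along a smooth vector field is smooth. -/
lemma ContDiffAt.fderiv_apply_field {E F : Type*} [NormedAddCommGroup E] [NormedSpace ℝ E]
    [NormedAddCommGroup F] [NormedSpace ℝ F] {f : E → F} {X : E → E} {q : E}
    (hf : ContDiffAt ℝ ∞ f q) (hX : ContDiffAt ℝ ∞ X q) :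
    ContDiffAt ℝ ∞ (fun p => fderiv ℝ f p (X p)) q :=
  (hf.fderiv_right (m := ∞) (by simp)).clm_apply hX

/-! ### Contact forms annihilating the next to last derived system. -/

namespace PlaneField

variable {E : Type} [NormedAddCommGroup E] [NormedSpace ℝ E]

/-- Functions `z, x_j, y_j` such that, near `p`, the forms `dx_j - y_j dz` annihilate the plane
field `D^(ν)`, and which are linearly independent at `p`. -/
structure IsContactCoframe (D : PlaneField 𝓘(ℝ, E) E) (ν : ℕ) {m : ℕ} (p : E) (z : E → ℝ)
    (x y : Fin m → E → ℝ) : Prop where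
  smooth_z : ∀ᶠ q in 𝓝 p, ContDiffAt ℝ ∞ z q
  smooth_x : ∀ j, ∀ᶠ q in 𝓝 p, ContDiffAt ℝ ∞ (x j) q
  smooth_y : ∀ j, ∀ᶠ q in 𝓝 p, ContDiffAt ℝ ∞ (y j) q
  annihilates : ∀ᶠ q in 𝓝 p, ∀ v ∈ D.flagAt ν q, ∀ j,
    fderiv ℝ (x j) q v = fderiv ℝ z q v * y j q
  surjective : ∀ w : Fin m → ℝ, ∃ v, ∀ j, fderiv ℝ (x j) p v - fderiv ℝ z p v * y j p = w j

variable [FiniteDimensional ℝ E] {D : PlaneField 𝓘(ℝ, E) E} {ν m : ℕ} {p : E}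

/-- The first integrals of an involutive subdistribution of corank one provide a coframe. -/
theorem exists_isContactCoframe {V : TopologicalSpace.Opens E} (hpV : p ∈ V)
    (hdim : Module.finrank ℝ E = (ν + 2) * m + 1)
    (hrank : ∀ q ∈ V, Module.finrank ℝ (D.flagAt ν q) = (ν + 1) * m + 1)
    (hinv : (D.derivedFlag ν).ContainsInvolutiveCorankOneAt p) :
    ∃ (z : E → ℝ) (x y : Fin m → E → ℝ), D.IsContactCoframe ν p z x y ∧
      ∃ U : TopologicalSpace.Opens E, p ∈ U ∧ ∃ B ∈ D.fields U ν, fderiv ℝ z p (B p) ≠ 0 := by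
  obtain ⟨U, hpU, L, k, hdist, hinvol, hLD⟩ := hinv
  obtain ⟨W, hpW, hWU, f, hf, hfs⟩ := hdist p hpU
  let f' : Fin k → E → E := f
  have hfs' : ∀ q ∈ W, LinearIndependent ℝ (fun j => f' j q) ∧
      L q = Submodule.span ℝ (Set.range fun j => f' j q) := hfs
  have hLle : ∀ q ∈ W, Submodule.span ℝ (Set.range fun j => f' j q) ≤ D.flagAt ν q := by
    intro q hq
    have h1 := (hLD q (hWU hq)).1
    rw [(hfs q hq).2] at h1
    exact h1
  have hLrank : ∀ q ∈ W, Module.finrank ℝ (D.flagAt ν q) =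
      Module.finrank ℝ (Submodule.span ℝ (Set.range fun j => f' j q)) + 1 := by
    intro q hq
    rw [finrank_span_eq_card (hfs' q hq).1, Fintype.card_fin]
    exact (hLD q (hWU hq)).2
  obtain ⟨h, hh1, hh2, hh3⟩ := Frobenius.exists_first_integral_of_involutive W.isOpen hpW f'
    (fun j => isSmoothOn_iff.1 (hf j)) (hfs' p hpW).1 (by
      intro O X Y hO hOW hX hY hXt hYt q hq
      let O' : TopologicalSpace.Opens E := ⟨O, hO⟩
      have hX' : X ∈ L.fields O' 0 := ⟨isSmoothOn_iff.2 hX, fun q hq => by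
        have := hXt q hq; rwa [← (hfs' q (hOW hq)).2] at this⟩
      have hY' : Y ∈ L.fields O' 0 := ⟨isSmoothOn_iff.2 hY, fun q hq => by
        have := hYt q hq; rwa [← (hfs' q (hOW hq)).2] at this⟩
      have h1 : VectorField.lieBracket ℝ X Y ∈ L.derivedModule O' 1 :=
        lieBracket_mem_fields hX' hY'
      rw [hinvol O' (fun q hq => hWU (hOW hq))] at h1
      have h2 := h1.2 q hq
      rwa [(hfs' q (hOW hq)).2] at h2)
  -- By the rank difference some field B of D^(ν) leaves L at p, and then D^(ν) is spanned by L and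
  -- B. The function z is a first integral of L normalised by dz(B) = 1 at p.
  obtain ⟨UB, hpUB, B, hB, hBL⟩ : ∃ U : TopologicalSpace.Opens E, p ∈ U ∧ ∃ B ∈ D.fields U ν,
      B p ∉ Submodule.span ℝ (Set.range fun j => f' j p) := by
    by_contra hcon
    push Not at hcon
    have h1 : D.flagAt ν p ≤ Submodule.span ℝ (Set.range fun j => f' j p) :=
      flagAt_le (V := ⊤) (fun U hU _ X hX => hcon U hU X hX) trivial
    have h2 := Submodule.finrank_mono h1
    have h3 := hLrank p hpW
    omega
  have hb : fderiv ℝ h p (B p) ≠ 0 := fun h0 => hBL (hh3 _ h0)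
  obtain ⟨lam, hlam⟩ := SeparatingDual.exists_eq_one (R := ℝ) hb
  obtain ⟨e⟩ : Nonempty ((E ⧸ D.flagAt ν p) ≃ₗ[ℝ] (Fin m → ℝ)) := by
    refine FiniteDimensional.nonempty_linearEquiv_of_finrank_eq ?_
    have h1 := (D.flagAt ν p).finrank_quotient_add_finrank
    rw [hrank p hpV, hdim] at h1
    rw [Module.finrank_fin_fun]
    have : (ν + 2) * m + 1 = m + ((ν + 1) * m + 1) := by ring
    omega
  let π : E →ₗ[ℝ] (Fin m → ℝ) := e.toLinearMap.comp (D.flagAt ν p).mkQ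
  -- The kernel of dh at p is contained in L(p), hence in D^(ν)(p), so the quotient map by D^(ν)(p)
  -- factors through dh. The functions x_j, components of μ₀ ∘ h, are thus first integrals of L
  -- whose differentials at p are exactly the equations of D^(ν)(p).
  obtain ⟨μ₀, hμ₀⟩ := LinearMap.exists_comp_eq_of_ker_le (fderiv ℝ h p).toLinearMap π (by
    intro v hv
    have h1 := hLle p hpW (hh3 v hv)
    rw [LinearMap.mem_ker, LinearMap.comp_apply, Submodule.mkQ_apply,
      (Submodule.Quotient.mk_eq_zero _).2 h1, map_zero])
  let μ : Fin m → E →L[ℝ] ℝ := fun j =>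
    (ContinuousLinearMap.proj j).comp (LinearMap.toContinuousLinearMap μ₀)
  have hdl : ∀ (l : E →L[ℝ] ℝ), ∀ᶠ q in 𝓝 p, ∀ v,
      fderiv ℝ (fun q => l (h q)) q v = l (fderiv ℝ h q v) := by
    intro l
    filter_upwards [hh1] with q hq v
    have h1 : HasFDerivAt (fun q => l (h q)) _ q :=
      l.hasFDerivAt.comp q (hq.differentiableAt (by simp)).hasFDerivAt
    rw [h1.fderiv]
    rfl
  have hsm : ∀ (l : E →L[ℝ] ℝ), ∀ᶠ q in 𝓝 p, ContDiffAt ℝ ∞ (fun q => l (h q)) q := by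
    intro l
    filter_upwards [hh1] with q hq using l.contDiff.contDiffAt.comp q hq
  have hBs : ∀ᶠ q in 𝓝 p, ContDiffAt ℝ ∞ B q := by
    filter_upwards [UB.isOpen.mem_nhds hpUB] with q hq using contDiffAt_of_mem_fields hB hq
  let z : E → ℝ := fun q => lam (h q)
  let x : Fin m → E → ℝ := fun j q => μ j (h q)
  have hzB1 : fderiv ℝ z p (B p) = 1 := by rw [(hdl lam).self_of_nhds, hlam]
  have hzBs : ∀ᶠ q in 𝓝 p, ContDiffAt ℝ ∞ (fun q => fderiv ℝ z q (B q)) q := by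
    filter_upwards [hsm lam, hBs] with q h1 h2 using h1.fderiv_apply_field h2
  have hzB : ∀ᶠ q in 𝓝 p, fderiv ℝ z q (B q) ≠ 0 :=
    hzBs.self_of_nhds.continuousAt.eventually_ne (by rw [hzB1]; exact one_ne_zero)
  -- The forms dx_j - y_j dz kill L for any y_j; this quotient is the choice that makes them kill B
  -- as well.
  refine ⟨z, x, fun j q => fderiv ℝ (x j) q (B q) / fderiv ℝ z q (B q), ⟨hsm lam,
    fun j => hsm (μ j), fun j => ?_, ?_, fun w => ?_⟩, UB, hpUB, B, hB, by
      rw [hzB1]; exact one_ne_zero⟩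
  · filter_upwards [hsm (μ j), hBs, hzBs, hzB] with q h1 h2 h3 h4
    exact (h1.fderiv_apply_field h2).div h3 h4
  · filter_upwards [W.isOpen.mem_nhds hpW, UB.isOpen.mem_nhds hpUB, hh2, hdl lam,
      eventually_all.2 fun j => hdl (μ j), hzB] with q hqW hqB hq2 hql hqm hqz v hv j
    have hkill : ∀ l ∈ Submodule.span ℝ (Set.range fun j => f' j q), fderiv ℝ h q l = 0 := by
      intro l hl
      refine (Submodule.span_le (p := LinearMap.ker (fderiv ℝ h q).toLinearMap)).2 ?_ hl
      rintro _ ⟨i, rfl⟩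
      exact hq2 i
    have hBq : B q ∉ Submodule.span ℝ (Set.range fun j => f' j q) := by
      intro hmem
      apply hqz
      rw [hql, hkill _ hmem, map_zero]
    obtain ⟨l, hl, c, rfl⟩ := Submodule.exists_eq_add_smul_of_finrank (hLle q hqW)
      (apply_mem_flagAt hB hqB) hBq (hLrank q hqW) hv
    have h1 : fderiv ℝ z q l = 0 := by rw [hql, hkill l hl, map_zero]
    have h2 : fderiv ℝ (x j) q l = 0 := by rw [hqm, hkill l hl, map_zero]
    rw [map_add, map_add, map_smul, map_smul, h1, h2, smul_eq_mul, smul_eq_mul]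
    field_simp
    ring
  -- B p lies in D^(ν)(p), so dx_j kills it and y_j vanishes at p. There the forms reduce to the
  -- dx_j, which are independent.
  · have hμB : ∀ j, fderiv ℝ (x j) p (B p) = 0 := by
      intro j
      rw [(hdl (μ j)).self_of_nhds]
      change μ₀ ((fderiv ℝ h p).toLinearMap (B p)) j = 0
      rw [hμ₀, LinearMap.comp_apply, Submodule.mkQ_apply,
        (Submodule.Quotient.mk_eq_zero _).2 (apply_mem_flagAt hB hpUB), map_zero]
      rfl
    obtain ⟨v, hv⟩ := Submodule.mkQ_surjective (D.flagAt ν p) (e.symm w)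
    refine ⟨v, fun j => ?_⟩
    rw [hμB, zero_div, mul_zero, sub_zero, (hdl (μ j)).self_of_nhds]
    change μ₀ ((fderiv ℝ h p).toLinearMap v) j = w j
    rw [hμ₀, LinearMap.comp_apply, hv]
    exact congrFun (e.apply_symm_apply w) j

/-- The values of the forms `dx_j - y_j dz`. -/
noncomputable def contactFormsAt (z : E → ℝ) (x y : Fin m → E → ℝ) (q : E) :
    E →ₗ[ℝ] (Fin m → ℝ) where
  toFun v := fun j => fderiv ℝ (x j) q v - fderiv ℝ z q v * y j q
  map_add' v w := by ext j; simp; ring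
  map_smul' c v := by ext j; simp; ring

omit [FiniteDimensional ℝ E] in
lemma contactFormsAt_apply (z : E → ℝ) (x y : Fin m → E → ℝ) (q v : E) (j : Fin m) :
    contactFormsAt z x y q v j = fderiv ℝ (x j) q v - fderiv ℝ z q v * y j q := rfl

/-- A coframe can be modified so that its first function is not constant along `D`. -/
theorem IsContactCoframe.exists_transverse {V : TopologicalSpace.Opens E} {r : ℕ} (hpV : p ∈ V)
    (hD : D.IsDistributionOn r V)
    (hrank : Module.finrank ℝ (D.flagAt ν p) = (ν + 1) * m + 1)
    (hrank0 : Module.finrank ℝ (D.flagAt 0 p) = m + 1)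
    (hlie : (D.lieFlag (ν + 1) p : Submodule ℝ E) = ⊤)
    {z : E → ℝ} {x y : Fin m → E → ℝ} (h : D.IsContactCoframe ν p z x y)
    (hB : ∃ U : TopologicalSpace.Opens E, p ∈ U ∧ ∃ B ∈ D.fields U ν, fderiv ℝ z p (B p) ≠ 0) :
    ∃ (z : E → ℝ) (x y : Fin m → E → ℝ), D.IsContactCoframe ν p z x y ∧
      ∃ U : TopologicalSpace.Opens E, p ∈ U ∧ ∃ X ∈ D.fields U 0, fderiv ℝ z p (X p) ≠ 0 := by
  by_cases hX : ∃ U : TopologicalSpace.Opens E, p ∈ U ∧ ∃ X ∈ D.fields U 0, fderiv ℝ z p (X p) ≠ 0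
  · exact ⟨z, x, y, h, hX⟩
  push Not at hX
  have hflag0 : ∀ v ∈ D.flagAt 0 p, fderiv ℝ z p v = 0 := by
    intro v hv
    exact flagAt_le (V := ⊤) (S := LinearMap.ker (fderiv ℝ z p).toLinearMap)
      (fun U hU _ X hX' => hX U hU X hX') trivial hv
  -- If ν or m is zero, the ranks give D(p) = D^(ν)(p), on which dz does not vanish.
  have hνm : 1 ≤ ν ∧ 1 ≤ m := by
    by_contra hcon
    have h1 : ν = 0 ∨ m = 0 := by omega
    have h2 : (ν + 1) * m + 1 = m + 1 := by rcases h1 with rfl | rfl <;> simp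
    have h3 : D.flagAt 0 p = D.flagAt ν p :=
      Submodule.eq_of_le_of_finrank_le (flagAt_mono (Nat.zero_le _)) (by omega)
    obtain ⟨U, hU, B, hB, hBz⟩ := hB
    exact hBz (hflag0 _ (h3 ▸ apply_mem_flagAt hB hU))
  obtain ⟨hν, hm⟩ := hνm
  have hann : ∀ U : TopologicalSpace.Opens E, ∀ A ∈ D.fields U ν, ∀ᶠ q in 𝓝 p, q ∈ U →
      ∀ j, ∀ᶠ q' in 𝓝 q, fderiv ℝ (x j) q' (A q') = fderiv ℝ z q' (A q') * y j q' := by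
    intro U A hA
    filter_upwards [h.annihilates.eventually_nhds] with q hq hqU j
    filter_upwards [hq, U.isOpen.mem_nhds hqU] with q' h1 h2
    exact h1 _ (apply_mem_flagAt hA h2) j
  have hsm : ∀ᶠ q in 𝓝 p, ContDiffAt ℝ ∞ z q ∧ ∀ j, ContDiffAt ℝ ∞ (x j) q ∧
      ContDiffAt ℝ ∞ (y j) q :=
    h.smooth_z.and (eventually_all.2 fun j => (h.smooth_x j).and (h.smooth_y j))
  have hform : ∀ U : TopologicalSpace.Opens E, ∀ A ∈ D.fields U ν, ∀ B ∈ D.fields U ν,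
      ∀ᶠ q in 𝓝 p, q ∈ U → ∀ j,
      contactFormsAt z x y q (VectorField.lieBracket ℝ A B q) j =
        fderiv ℝ z q (B q) * fderiv ℝ (y j) q (A q) -
          fderiv ℝ z q (A q) * fderiv ℝ (y j) q (B q) := by
    intro U A hA B hB
    filter_upwards [hann U A hA, hann U B hB, hsm] with q h1 h2 ⟨h3, h4⟩ hqU j
    exact contactForm_lieBracket (differentiableAt_of_mem_fields hA hqU)
      (differentiableAt_of_mem_fields hB hqU) ((h4 j).1.of_le (by exact WithTop.coe_le_coe.2 le_top))
      ((h4 j).2.differentiableAt (by simp)) (h3.of_le (by exact WithTop.coe_le_coe.2 le_top))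
      (h1 hqU j) (h2 hqU j)
  let Y : E →ₗ[ℝ] (Fin m → ℝ) := LinearMap.pi fun j => (fderiv ℝ (y j) p).toLinearMap
  -- At p, for A in D and B in D^(ν), the form dx_j - y_j dz takes the value dz(B) dy_j(A) on [A,
  -- B], because dz(A) = 0. By D_{ν+1}(p) = T_pM these values fill ℝ^m, so the dy_j are independent
  -- on D(p).
  have hY : ∀ w, ∃ v ∈ D.flagAt 0 p, Y v = w := by
    have h1 : (⊤ : Submodule ℝ E) ≤
        ((D.flagAt 0 p).map Y).comap (contactFormsAt z x y p) := by
      refine hlie.ge.trans (lieFlag_succ_le D ν p (fun U hU A hA => ?_) fun U hU A hA B hB => ?_)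
      · have h2 : contactFormsAt z x y p (A p) = 0 := by
          ext j
          exact sub_eq_zero.2 (h.annihilates.self_of_nhds _ (apply_mem_flagAt hA hU) j)
        rw [Submodule.mem_comap, h2]
        exact Submodule.zero_mem _
      · refine ⟨fderiv ℝ z p (B p) • A p,
          Submodule.smul_mem _ _ (apply_mem_flagAt hA hU), ?_⟩
        ext j
        rw [(hform U A (fields_mono hA (Nat.zero_le _)) B hB).self_of_nhds hU j, hX U hU A hA,
          zero_mul, sub_zero, map_smul]
        rfl
    intro w
    obtain ⟨v, hv⟩ := h.surjective w
    obtain ⟨u, hu, huw⟩ := h1 (Submodule.mem_top (x := v))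
    exact ⟨u, hu, huw.trans (funext hv)⟩
  -- For m ≥ 2 the vanishing of dz on D(p) is contradictory; for m = 1 it can really occur, and the
  -- coframe must be changed.
  rcases Nat.lt_or_ge 1 m with hm2 | hm1
  · exfalso
    have hj : (⟨0, by omega⟩ : Fin m) ≠ ⟨1, hm2⟩ := by simp
    set j₀ : Fin m := ⟨0, by omega⟩
    set j₁ : Fin m := ⟨1, hm2⟩
    obtain ⟨v₀, hv₀, hYv₀⟩ := hY (Pi.single j₀ 1)
    obtain ⟨v₁, hv₁, hYv₁⟩ := hY (Pi.single j₁ 1)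
    obtain ⟨U₀, hU₀, A₀, hA₀, rfl⟩ := exists_field_of_mem_flagAt_zero hD hpV hv₀
    obtain ⟨U₁, hU₁, A₁, hA₁, rfl⟩ := exists_field_of_mem_flagAt_zero hD hpV hv₁
    have hd : ∀ (U : TopologicalSpace.Opens E) (A : E → E), p ∈ U → A ∈ D.fields U 0 →
        ∀ j, ContinuousAt (fun q => fderiv ℝ (y j) q (A q)) p := fun U A hU hA j =>
      ((h.smooth_y j).self_of_nhds.fderiv_apply_field
        (contDiffAt_of_mem_fields hA hU)).continuousAt
    have hval : ∀ v j, fderiv ℝ (y j) p v = Y v j := fun _ _ => rfl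
    have hdet : ∀ᶠ q in 𝓝 p, fderiv ℝ (y j₀) q (A₀ q) * fderiv ℝ (y j₁) q (A₁ q) -
        fderiv ℝ (y j₁) q (A₀ q) * fderiv ℝ (y j₀) q (A₁ q) ≠ 0 := by
      refine ContinuousAt.eventually_ne
        (((hd _ _ hU₀ hA₀ j₀).mul (hd _ _ hU₁ hA₁ j₁)).sub
          ((hd _ _ hU₀ hA₀ j₁).mul (hd _ _ hU₁ hA₁ j₀))) ?_
      simp only [hval, hYv₀, hYv₁]
      simp [Pi.single_eq_of_ne hj, Pi.single_eq_of_ne hj.symm]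
    have hdet0 : ∀ᶠ q in 𝓝 p, fderiv ℝ (y j₀) q (A₀ q) ≠ 0 := by
      refine (hd _ _ hU₀ hA₀ j₀).eventually_ne ?_
      simp [hval, hYv₀]
    -- As ν ≥ 1, brackets of fields of D lie in D^(ν), so every dz ∧ dy_j vanishes on D near p. Two
    -- of the dy_j being independent on D, this forces dz to vanish on D throughout a neighbourhood.
    have hrel : ∀ᶠ q in 𝓝 p, ∀ U : TopologicalSpace.Opens E, q ∈ U → ∀ A ∈ D.fields U 0,
        ∀ B ∈ D.fields U 0, ∀ j, fderiv ℝ z q (B q) * fderiv ℝ (y j) q (A q) -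
          fderiv ℝ z q (A q) * fderiv ℝ (y j) q (B q) = 0 := by
      filter_upwards [h.annihilates.eventually_nhds, hsm] with q hq ⟨h3, h4⟩ U hqU A hA B hB j
      have hAB : ∀ C ∈ D.fields U 0, ∀ᶠ q' in 𝓝 q,
          fderiv ℝ (x j) q' (C q') = fderiv ℝ z q' (C q') * y j q' := by
        intro C hC
        filter_upwards [hq, U.isOpen.mem_nhds hqU] with q' h1 h2
        exact h1 _ (apply_mem_flagAt (fields_mono hC (Nat.zero_le _)) h2) j
      rw [← contactForm_lieBracket (differentiableAt_of_mem_fields hA hqU)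
        (differentiableAt_of_mem_fields hB hqU) ((h4 j).1.of_le (by exact WithTop.coe_le_coe.2 le_top))
        ((h4 j).2.differentiableAt (by simp)) (h3.of_le (by exact WithTop.coe_le_coe.2 le_top))
        (hAB A hA) (hAB B hB)]
      exact sub_eq_zero.2 (hq.self_of_nhds _ (apply_mem_flagAt
        (fields_mono (lieBracket_mem_fields hA hB) hν) hqU) j)
    have hkill : ∀ᶠ q in 𝓝 p, ∀ U : TopologicalSpace.Opens E, q ∈ U → ∀ A ∈ D.fields U 0,
        fderiv ℝ z q (A q) = 0 := by
      filter_upwards [hrel, hdet, hdet0, U₀.isOpen.mem_nhds hU₀, U₁.isOpen.mem_nhds hU₁]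
        with q hq hq1 hq2 hq3 hq4 U hqU A hA
      have e0 := hq (U₀ ⊓ U₁) ⟨hq3, hq4⟩ A₀ (fields_mono_open hA₀ inf_le_left) A₁
        (fields_mono_open hA₁ inf_le_right) j₀
      have e1 := hq (U₀ ⊓ U₁) ⟨hq3, hq4⟩ A₀ (fields_mono_open hA₀ inf_le_left) A₁
        (fields_mono_open hA₁ inf_le_right) j₁
      have hA0z : fderiv ℝ z q (A₀ q) = 0 := by
        refine (mul_eq_zero.1 (?_ : fderiv ℝ z q (A₀ q) *
          (fderiv ℝ (y j₀) q (A₀ q) * fderiv ℝ (y j₁) q (A₁ q) -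
            fderiv ℝ (y j₁) q (A₀ q) * fderiv ℝ (y j₀) q (A₁ q)) = 0)).resolve_right hq1
        linear_combination fderiv ℝ (y j₁) q (A₀ q) * e0 - fderiv ℝ (y j₀) q (A₀ q) * e1
      have e2 := hq (U₀ ⊓ U) ⟨hq3, hqU⟩ A₀ (fields_mono_open hA₀ inf_le_left) A
        (fields_mono_open hA inf_le_right) j₀
      rw [hA0z, zero_mul, sub_zero] at e2
      exact (mul_eq_zero.1 e2).resolve_right hq2
    -- The closed form dz kills brackets of fields that it kills, hence the whole derived flag near
    -- p. This contradicts the existence of B in D^(ν) with dz(B) nonzero at p.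
    have hkillall : ∀ i, ∀ᶠ q in 𝓝 p, ∀ U : TopologicalSpace.Opens E, q ∈ U →
        ∀ A ∈ D.fields U i, fderiv ℝ z q (A q) = 0 := by
      intro i
      induction i with
      | zero => exact hkill
      | succ i ih =>
        filter_upwards [ih.eventually_nhds, h.smooth_z] with q hq hqz U hqU A hA
        refine apply_mem_of_mem_fields_succ (S := LinearMap.ker (fderiv ℝ z q).toLinearMap)
          hA hqU (fun B hB => hq.self_of_nhds U hqU B hB) fun B hB C hC => ?_
        -- The bracket formula is applied to the form dz itself, with the zero function in the other
        -- two roles.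
        have hBC : ∀ C ∈ D.fields U i, ∀ᶠ q' in 𝓝 q, fderiv ℝ z q' (C q') =
            fderiv ℝ (fun _ : E => (0 : ℝ)) q' (C q') * (fun _ : E => (0 : ℝ)) q' := by
          intro C hC
          filter_upwards [hq, U.isOpen.mem_nhds hqU] with q' h1 h2
          rw [h1 U h2 C hC, mul_zero]
        have := contactForm_lieBracket (differentiableAt_of_mem_fields hB hqU)
          (differentiableAt_of_mem_fields hC hqU)
          (hqz.of_le (by exact WithTop.coe_le_coe.2 le_top))
          (differentiableAt_const _) contDiffAt_const (hBC B hB) (hBC C hC)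
        simpa using this
    obtain ⟨U, hU, B, hB, hBz⟩ := hB
    exact hBz ((hkillall ν).self_of_nhds U hU B hB)
  · obtain rfl : m = 1 := by omega
    obtain ⟨v, hv, hYv⟩ := hY (fun _ => 1)
    obtain ⟨U, hU, A, hA, rfl⟩ := exists_field_of_mem_flagAt_zero hD hpV hv
    have hder : ∀ᶠ q in 𝓝 p, ∀ v, fderiv ℝ (fun q => x 0 q - y 0 q * z q) q v =
        fderiv ℝ (x 0) q v - (y 0 q * fderiv ℝ z q v + z q * fderiv ℝ (y 0) q v) := by
      filter_upwards [hsm] with q ⟨h1, h2⟩ v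
      have dz := h1.differentiableAt (by simp)
      have dx := (h2 0).1.differentiableAt (by simp)
      have dy := (h2 0).2.differentiableAt (by simp)
      have e := dx.hasFDerivAt.sub (dy.hasFDerivAt.mul dz.hasFDerivAt)
      rw [show fderiv ℝ (fun q => x 0 q - y 0 q * z q) q = _ from e.fderiv]
      simp
    -- Legendre transformation: dx - y dz = d(x - y z) + z dy. The same form is rewritten with y as
    -- the new independent variable, and y is not constant along A.
    refine ⟨y 0, fun _ q => x 0 q - y 0 q * z q, fun _ q => - z q, ⟨h.smooth_y 0, fun _ => ?_,
      fun _ => ?_, ?_, fun w => ?_⟩, U, hU, A, hA, ?_⟩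
    · filter_upwards [hsm] with q ⟨h1, h2⟩ using (h2 0).1.sub ((h2 0).2.mul h1)
    · filter_upwards [h.smooth_z] with q h1 using h1.neg
    · filter_upwards [h.annihilates, hder] with q h1 h2 v hv j
      rw [h2, h1 v hv 0]
      ring
    · obtain ⟨v, hv⟩ := h.surjective w
      refine ⟨v, fun j => ?_⟩
      rw [Subsingleton.elim j 0, ← hv 0, hder.self_of_nhds]
      ring
    · have : fderiv ℝ (y 0) p (A p) = 1 := congrFun hYv 0
      rw [this]
      exact one_ne_zero

end PlaneField

/-- The inverse function theorem on finite-dimensional spaces, for smooth maps. -/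
lemma exists_isLocalDiffeo_of_injective_fderiv {E F : Type*} [NormedAddCommGroup E]
    [NormedSpace ℝ E] [FiniteDimensional ℝ E] [NormedAddCommGroup F] [NormedSpace ℝ F]
    [FiniteDimensional ℝ F] (hdim : Module.finrank ℝ E = Module.finrank ℝ F) {f : E → F}
    {W : TopologicalSpace.Opens E} {p : E} (hp : p ∈ W) (hf : ∀ q ∈ W, ContDiffAt ℝ ∞ f q)
    (hinj : ∀ v, fderiv ℝ f p v = 0 → v = 0) :
    ∃ φ : OpenPartialHomeomorph E F, (∀ q, φ q = f q) ∧ p ∈ φ.source ∧ φ.source ⊆ W ∧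
      PlaneField.IsLocalDiffeo 𝓘(ℝ, E) 𝓘(ℝ, F) φ := by
  let R : Set (E →L[ℝ] F) := Set.range ((↑) : (E ≃L[ℝ] F) → E →L[ℝ] F)
  have hR : IsOpen R := ContinuousLinearEquiv.isOpen
  obtain ⟨e, he⟩ : fderiv ℝ f p ∈ R :=
    ⟨(LinearEquiv.ofInjectiveOfFinrankEq (fderiv ℝ f p).toLinearMap
      (LinearMap.ker_eq_bot.1 (LinearMap.ker_eq_bot'.2 hinj)) hdim).toContinuousLinearEquiv, by
        ext v; rfl⟩
  have hW : ContinuousOn (fderiv ℝ f) W := fun q hq =>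
    ((hf q hq).fderiv_right (m := 0) (by simp)).continuousAt.continuousWithinAt
  have hS : IsOpen ((W : Set E) ∩ fderiv ℝ f ⁻¹' R) := hW.isOpen_inter_preimage W.isOpen hR
  have hfp : HasFDerivAt f (e : E →L[ℝ] F) p := by
    rw [he]
    exact ((hf p hp).differentiableAt (by simp)).hasFDerivAt
  let φ₀ := (hf p hp).toOpenPartialHomeomorph f hfp (by simp)
  have hφ₀ : ∀ q, φ₀ q = f q := fun q => rfl
  -- On the points of W with invertible derivative the inverse is smooth everywhere, not only at the
  -- image of p.
  let φ := φ₀.restrOpen _ hS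
  have hsrc : φ.source = φ₀.source ∩ ((W : Set E) ∩ fderiv ℝ f ⁻¹' R) :=
    φ₀.restrOpen_source _ hS
  have hφ : ∀ q, φ q = f q := fun q => rfl
  refine ⟨φ, hφ, ?_, ?_, ?_, ?_⟩
  · rw [hsrc]
    exact ⟨(hf p hp).mem_toOpenPartialHomeomorph_source hfp (by simp), hp, e, he⟩
  · rw [hsrc]
    exact fun q hq => hq.2.1
  · refine contMDiffOn_iff_contDiffOn.2 fun q hq => ?_
    rw [hsrc] at hq
    exact (hf q hq.2.1).contDiffWithinAt
  · refine contMDiffOn_iff_contDiffOn.2 fun y hy => ContDiffAt.contDiffWithinAt ?_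
    have h1 : φ.symm y ∈ φ.source := φ.map_target hy
    rw [hsrc] at h1
    obtain ⟨-, h2, e', he'⟩ := h1
    refine φ.contDiffAt_symm (f₀' := e') hy ?_ (hf _ h2)
    rw [he']
    exact ((hf _ h2).differentiableAt (by simp)).hasFDerivAt

/-! ### Contact coordinates by successive differentiation along a transverse field. -/

namespace PlaneField

variable {E : Type} [NormedAddCommGroup E] [NormedSpace ℝ E] [FiniteDimensional ℝ E]

/-- Functions `z` and `g l j`, for all `l`, such that `dz` takes the value `1` on the field `X` of
`D`, the functions `g (l + 1) j` are the derivatives of the `g l j` along `X`, and the forms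
`d(g 0 j) - (g 1 j) dz` annihilate the `ν`-th derived system of `D`. -/
structure IsProlongation (D : PlaneField 𝓘(ℝ, E) E) (ν : ℕ) {m : ℕ}
    (W : TopologicalSpace.Opens E) (X : E → E) (z : E → ℝ) (g : ℕ → Fin m → E → ℝ) : Prop where
  mem_fields : X ∈ D.fields W 0
  fderiv_z : ∀ q ∈ W, fderiv ℝ z q (X q) = 1
  smooth_z : ∀ q ∈ W, ContDiffAt ℝ ∞ z q
  smooth_g : ∀ l j, ∀ q ∈ W, ContDiffAt ℝ ∞ (g l j) q
  fderiv_g : ∀ l j, ∀ q ∈ W, fderiv ℝ (g l j) q (X q) = g (l + 1) j q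
  annihilates : ∀ q ∈ W, ∀ v ∈ D.flagAt ν q, ∀ j,
    fderiv ℝ (g 0 j) q v = fderiv ℝ z q v * g 1 j q

variable {D : PlaneField 𝓘(ℝ, E) E} {ν m : ℕ} {p : E}

/-- X is rescaled so that dz(X) = 1, and the g l are the iterated derivatives of the x_j along it.
Since X lies in D^(ν), evaluating dx_j = y_j dz on X shows that g 1 j is y_j, so the coframe forms
are those of order zero. -/
lemma IsContactCoframe.exists_isProlongation {z : E → ℝ} {x y : Fin m → E → ℝ}
    (h : D.IsContactCoframe ν p z x y) {U : TopologicalSpace.Opens E} (hpU : p ∈ U) {X : E → E}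
    (hX : X ∈ D.fields U 0) (hzX : fderiv ℝ z p (X p) ≠ 0) {V : TopologicalSpace.Opens E}
    (hpV : p ∈ V) :
    ∃ W : TopologicalSpace.Opens E, p ∈ W ∧ W ≤ V ∧
      ∃ (X : E → E) (g : ℕ → Fin m → E → ℝ), D.IsProlongation ν W X z g ∧
        ∀ w : Fin m → ℝ, ∃ v, ∀ j, fderiv ℝ (g 0 j) p v - fderiv ℝ z p v * g 1 j p = w j := by
  have hzX' : ∀ᶠ q in 𝓝 p, fderiv ℝ z q (X q) ≠ 0 :=
    (h.smooth_z.self_of_nhds.fderiv_apply_field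
      (contDiffAt_of_mem_fields hX hpU)).continuousAt.eventually_ne hzX
  have hUV : ∀ᶠ q in 𝓝 p, q ∈ U ∧ q ∈ V :=
    Filter.Eventually.and (U.isOpen.mem_nhds hpU) (V.isOpen.mem_nhds hpV)
  obtain ⟨S, hS, hSo, hpS⟩ := eventually_nhds_iff.1 (h.smooth_z.and ((eventually_all.2
    h.smooth_x).and (h.annihilates.and (hzX'.and hUV))))
  let W : TopologicalSpace.Opens E := ⟨S, hSo⟩
  have hzs : ∀ q ∈ W, ContDiffAt ℝ ∞ z q := fun q hq => (hS q hq).1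
  have hWU : W ≤ U := fun q hq => (hS q hq).2.2.2.2.1
  have hXs : ∀ q ∈ W, ContDiffAt ℝ ∞ X q := fun q hq => contDiffAt_of_mem_fields hX (hWU hq)
  have hne : ∀ q ∈ W, fderiv ℝ z q (X q) ≠ 0 := fun q hq => (hS q hq).2.2.2.1
  let X' : E → E := fun q => (fderiv ℝ z q (X q))⁻¹ • X q
  have hX' : X' ∈ D.fields W 0 := smul_mem_fields_zero (fields_mono_open hX hWU) fun q hq =>
    (((hzs q hq).fderiv_apply_field (hXs q hq)).inv (hne q hq)).contDiffWithinAt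
  have hzX1 : ∀ q ∈ W, fderiv ℝ z q (X' q) = 1 := fun q hq => by
    rw [map_smul, smul_eq_mul, inv_mul_cancel₀ (hne q hq)]
  let g : ℕ → Fin m → E → ℝ := fun l => Nat.rec x (fun _ f j q => fderiv ℝ (f j) q (X' q)) l
  have hy : ∀ q ∈ W, ∀ j, g 1 j q = y j q := fun q hq j => by
    have := (hS q hq).2.2.1 (X' q) (flagAt_mono (Nat.zero_le _) (apply_mem_flagAt hX' hq)) j
    rwa [hzX1 q hq, one_mul] at this
  refine ⟨W, hpS, fun q hq => (hS q hq).2.2.2.2.2, X', g, ⟨hX', hzX1, hzs, fun l => ?_,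
    fun _ _ _ _ => rfl, fun q hq v hv j => ?_⟩, fun w => ?_⟩
  · induction l with
    | zero => exact fun j q hq => (hS q hq).2.1 j
    | succ l ih =>
      exact fun j q hq => (ih j q hq).fderiv_apply_field (contDiffAt_of_mem_fields hX' hq)
  · rw [hy q hq j]
    exact (hS q hq).2.2.1 v hv j
  · obtain ⟨v, hv⟩ := h.surjective w
    refine ⟨v, fun j => ?_⟩
    rw [hy p hpS j]
    exact hv j

namespace IsProlongation

variable {W : TopologicalSpace.Opens E} {X : E → E} {z : E → ℝ} {g : ℕ → Fin m → E → ℝ}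

/-- For Y in D^(k) the bracket [Y, X] lies in D^(k+1), so the form of order l kills it by induction.
By `contactForm_lieBracket` and dz(X) = 1, its value there is also that of the form of order l + 1
on Y. -/
lemma contactForm_eq_zero (h : D.IsProlongation ν W X z g) {l k : ℕ} (hlk : l + k ≤ ν)
    {U : TopologicalSpace.Opens E} (hU : U ≤ W) {Y : E → E} (hY : Y ∈ D.fields U k) {q : E}
    (hq : q ∈ U) (j : Fin m) :
    fderiv ℝ (g l j) q (Y q) = fderiv ℝ z q (Y q) * g (l + 1) j q := by
  induction l generalizing k Y q with
  | zero =>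
    exact h.annihilates q (hU hq) _ (flagAt_mono (by omega) (apply_mem_flagAt hY hq)) j
  | succ l ih =>
    have hX : X ∈ D.fields U k := fields_mono (fields_mono_open h.mem_fields hU) (Nat.zero_le _)
    have hn := U.isOpen.mem_nhds hq
    have key := contactForm_lieBracket (differentiableAt_of_mem_fields hY hq)
      (differentiableAt_of_mem_fields hX hq)
      ((h.smooth_g l j q (hU hq)).of_le (by exact WithTop.coe_le_coe.2 le_top))
      ((h.smooth_g (l + 1) j q (hU hq)).differentiableAt (by simp))
      ((h.smooth_z q (hU hq)).of_le (by exact WithTop.coe_le_coe.2 le_top))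
      (by filter_upwards [hn] with q' hq' using ih (k := k) (by omega) hY hq')
      (by filter_upwards [hn] with q' hq' using ih (k := k) (by omega) hX hq')
    rw [ih (k := k + 1) (by omega) (lieBracket_mem_fields hY hX) hq, sub_self,
      h.fderiv_z q (hU hq), h.fderiv_g _ j q (hU hq)] at key
    linarith

lemma flagAt_le_ker (h : D.IsProlongation ν W X z g) {l k : ℕ} (hlk : l + k ≤ ν) {q : E}
    (hq : q ∈ W) : D.flagAt k q ≤ LinearMap.ker (contactFormsAt z (g l) (g (l + 1)) q) := by
  refine flagAt_le (fun U hqU hU Y hY => LinearMap.mem_ker.2 (funext fun j => ?_)) hq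
  exact sub_eq_zero.2 (h.contactForm_eq_zero hlk hU hY hqU j)

/-- For A, B in D^(k), the form of order l on [A, B] equals the form of order l + 1 on dz(B) A -
dz(A) B, which again lies in D^(k). Surjectivity on D^(k+1) therefore passes to surjectivity of the
next form on D^(k), starting from the independence of the coframe on the whole tangent space. -/
lemma map_flagAt (h : D.IsProlongation ν W X z g) (hp : p ∈ W) (htop : D.flagAt (ν + 1) p = ⊤)
    (hsurj : ∀ w : Fin m → ℝ, ∃ v, ∀ j, fderiv ℝ (g 0 j) p v - fderiv ℝ z p v * g 1 j p = w j)
    {l k : ℕ} (hlk : l + k = ν + 1) :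
    (D.flagAt k p).map (contactFormsAt z (g l) (g (l + 1)) p) = ⊤ := by
  induction l generalizing k with
  | zero =>
    obtain rfl : k = ν + 1 := by omega
    rw [htop, Submodule.map_top]
    refine LinearMap.range_eq_top.2 fun w => ?_
    obtain ⟨v, hv⟩ := hsurj w
    exact ⟨v, funext hv⟩
  | succ l ih =>
    refine eq_top_iff.2 ((ih (k := k + 1) (by omega)).ge.trans (Submodule.map_le_iff_le_comap.2 ?_))
    refine flagAt_le (fun U hpU hU Y hY => apply_mem_of_mem_fields_succ hY hpU
      (fun A hA => ?_) fun A hA B hB => ?_) hp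
    · have h0 : contactFormsAt z (g l) (g (l + 1)) p (A p) = 0 :=
        LinearMap.mem_ker.1 (h.flagAt_le_ker (by omega) hp (apply_mem_flagAt hA hpU))
      rw [Submodule.mem_comap, h0]
      exact Submodule.zero_mem _
    · refine ⟨fderiv ℝ z p (B p) • A p - fderiv ℝ z p (A p) • B p, Submodule.sub_mem _
        (Submodule.smul_mem _ _ (apply_mem_flagAt hA hpU))
        (Submodule.smul_mem _ _ (apply_mem_flagAt hB hpU)), funext fun j => ?_⟩
      have hn := U.isOpen.mem_nhds hpU
      have key := contactForm_lieBracket (differentiableAt_of_mem_fields hA hpU)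
        (differentiableAt_of_mem_fields hB hpU)
        ((h.smooth_g l j p hp).of_le (by exact WithTop.coe_le_coe.2 le_top))
        ((h.smooth_g (l + 1) j p hp).differentiableAt (by simp))
        ((h.smooth_z p hp).of_le (by exact WithTop.coe_le_coe.2 le_top))
        (by filter_upwards [hn] with q hq using
          h.contactForm_eq_zero (k := k) (by omega) hU hA hq j)
        (by filter_upwards [hn] with q hq using
          h.contactForm_eq_zero (k := k) (by omega) hU hB hq j)
      refine Eq.trans ?_ key.symm
      simp only [contactFormsAt_apply, map_sub, map_smul, smul_eq_mul]
      ring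

/-- By surjectivity, the kernel of the form of order l in D^(k+1)(p), where l + k = ν, has
codimension m there, which is the rank of D^(k)(p); the two coincide. A vector killed by dz and all
dg_l descends through these kernels. -/
lemma mem_flagAt (h : D.IsProlongation ν W X z g) (hp : p ∈ W) (htop : D.flagAt (ν + 1) p = ⊤)
    (hsurj : ∀ w : Fin m → ℝ, ∃ v, ∀ j, fderiv ℝ (g 0 j) p v - fderiv ℝ z p v * g 1 j p = w j)
    (hrank : ∀ i ≤ ν + 1, Module.finrank ℝ (D.flagAt i p) = (i + 1) * m + 1) {v : E}
    (hz : fderiv ℝ z p v = 0) (hg : ∀ l ≤ ν + 1, ∀ j, fderiv ℝ (g l j) p v = 0)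
    {l k : ℕ} (hlk : l + k = ν + 1) : v ∈ D.flagAt k p := by
  induction l generalizing k with
  | zero =>
    obtain rfl : k = ν + 1 := by omega
    rw [htop]
    trivial
  | succ l ih =>
    let θ := contactFormsAt z (g l) (g (l + 1)) p
    have heq : D.flagAt k p = D.flagAt (k + 1) p ⊓ LinearMap.ker θ := by
      refine Submodule.eq_of_le_of_finrank_le
        (le_inf (flagAt_mono (Nat.le_succ k)) (h.flagAt_le_ker (by omega) hp)) ?_
      have h1 := Submodule.finrank_map_add_finrank_inf_ker (D.flagAt (k + 1) p) θ
      rw [h.map_flagAt hp htop hsurj (by omega), finrank_top, Module.finrank_fin_fun,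
        hrank (k + 1) (by omega)] at h1
      rw [hrank k (by omega)]
      nlinarith
    rw [heq]
    refine ⟨ih (by omega), LinearMap.mem_ker.2 (funext fun j => ?_)⟩
    rw [contactFormsAt_apply, hz, hg l (by omega) j]
    simp

/-- Such a vector lies in D(p) and in the kernel of the form of order ν + 1. That kernel has
dimension m + 1 - m = 1 in D(p) and contains X p, on which dz is 1. The function g (ν + 2), which is
not a coordinate, enters only through this last form. -/
lemma eq_zero (h : D.IsProlongation ν W X z g) (hp : p ∈ W) (htop : D.flagAt (ν + 1) p = ⊤)
    (hsurj : ∀ w : Fin m → ℝ, ∃ v, ∀ j, fderiv ℝ (g 0 j) p v - fderiv ℝ z p v * g 1 j p = w j)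
    (hrank : ∀ i ≤ ν + 1, Module.finrank ℝ (D.flagAt i p) = (i + 1) * m + 1) {v : E}
    (hz : fderiv ℝ z p v = 0) (hg : ∀ l ≤ ν + 1, ∀ j, fderiv ℝ (g l j) p v = 0) : v = 0 := by
  let θ := contactFormsAt z (g (ν + 1)) (g (ν + 1 + 1)) p
  have hv : v ∈ D.flagAt 0 p ⊓ LinearMap.ker θ := by
    refine ⟨h.mem_flagAt hp htop hsurj hrank hz hg (l := ν + 1) rfl,
      LinearMap.mem_ker.2 (funext fun j => ?_)⟩
    rw [contactFormsAt_apply, hz, hg _ le_rfl j]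
    simp
  have hX : X p ∈ D.flagAt 0 p ⊓ LinearMap.ker θ := by
    refine ⟨apply_mem_flagAt h.mem_fields hp, LinearMap.mem_ker.2 (funext fun j => ?_)⟩
    rw [contactFormsAt_apply, h.fderiv_z p hp, h.fderiv_g _ j p hp]
    simp
  have h1 := Submodule.finrank_map_add_finrank_inf_ker (D.flagAt 0 p) θ
  rw [h.map_flagAt hp htop hsurj (l := ν + 1) rfl, finrank_top, Module.finrank_fin_fun,
    hrank 0 (by omega)] at h1
  have hX0 : X p ≠ 0 := fun h0 => by
    have := h.fderiv_z p hp
    rw [h0, map_zero] at this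
    exact zero_ne_one this
  have h2 : Module.finrank ℝ (D.flagAt 0 p ⊓ LinearMap.ker θ : Submodule ℝ E) = 1 := by omega
  obtain ⟨c, hc⟩ := (finrank_eq_one_iff_of_nonzero'
    (⟨X p, hX⟩ : (D.flagAt 0 p ⊓ LinearMap.ker θ : Submodule ℝ E))
    (fun h0 => hX0 (congrArg Subtype.val h0))).1 h2 ⟨v, hv⟩
  have hc' : c • X p = v := congrArg Subtype.val hc
  rw [← hc', map_smul, h.fderiv_z p hp, smul_eq_mul, mul_one] at hz
  rw [← hc', hz, zero_smul]

end IsProlongation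

/-- A distribution with the derived flag and the Lie flag of the contact system, whose next to last
derived system contains an involutive subdistribution of corank one, is locally equivalent to the
contact system. -/
theorem locallyEquivalentAt_contactSystem {V : TopologicalSpace.Opens E} (hpV : p ∈ V)
    (hdim : Module.finrank ℝ E = (ν + 2) * m + 1) (hD : D.IsDistributionOn (m + 1) V)
    (hrank : ∀ i ≤ ν + 1, ∀ q ∈ V, Module.finrank ℝ (D.flagAt i q) = (i + 1) * m + 1)
    (hlie : (D.lieFlag (ν + 1) p : Submodule ℝ E) = ⊤)
    (hinv : (D.derivedFlag ν).ContainsInvolutiveCorankOneAt p) :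
    D.LocallyEquivalentAt (JetSpace.contactSystem (ν + 1) m) p := by
  obtain ⟨z₀, x₀, y₀, h₀, hB⟩ := exists_isContactCoframe hpV hdim (hrank ν (by omega)) hinv
  obtain ⟨z, x, y, hxy, U, hpU, X₀, hX₀, hzX₀⟩ := h₀.exists_transverse hpV hD
    (hrank ν (by omega) p hpV) (by simpa using hrank 0 (by omega) p hpV) hlie hB
  obtain ⟨W, hpW, hWV, X, g, h, hsurj⟩ := hxy.exists_isProlongation hpU hX₀ hzX₀ hpV
  have htop : D.flagAt (ν + 1) p = ⊤ := by
    refine Submodule.eq_top_of_finrank_eq ?_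
    rw [hrank _ le_rfl p hpV, hdim]
  let Φ : E → JetSpace (ν + 1) m := fun q => (z q, fun l j => g l j q)
  have hΦ : ∀ q ∈ W, ContDiffAt ℝ ∞ Φ q := fun q hq =>
    (h.smooth_z q hq).prodMk (contDiffAt_pi.2 fun l => contDiffAt_pi.2 fun j => h.smooth_g l j q hq)
  have hdΦ : ∀ q ∈ W, ∀ v, fderiv ℝ Φ q v =
      (fderiv ℝ z q v, fun (l : Fin (ν + 1 + 1)) j => fderiv ℝ (g l j) q v) := by
    intro q hq v
    have h1 : HasFDerivAt Φ ((fderiv ℝ z q).prod (ContinuousLinearMap.pi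
        fun l : Fin (ν + 1 + 1) => ContinuousLinearMap.pi fun j => fderiv ℝ (g l j) q)) q :=
      ((h.smooth_z q hq).differentiableAt (by simp)).hasFDerivAt.prodMk
        (hasFDerivAt_pi.2 fun l => hasFDerivAt_pi.2 fun j =>
          ((h.smooth_g l j q hq).differentiableAt (by simp)).hasFDerivAt)
    rw [h1.fderiv]
    rfl
  obtain ⟨φ, hφΦ, hpφ, hφW, hφ⟩ := exists_isLocalDiffeo_of_injective_fderiv
    (by rw [hdim, JetSpace.finrank_jetSpace]) hpW hΦ fun v hv => by
      rw [hdΦ p hpW] at hv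
      refine h.eq_zero hpW htop hsurj (fun i hi => hrank i hi p hpV) (congrArg Prod.fst hv)
        fun l hl j => ?_
      exact congrFun (congrFun (congrArg Prod.snd hv) (⟨l, by omega⟩ : Fin (ν + 1 + 1))) j
  have hΦφ : ⇑φ = Φ := funext hφΦ
  let F : PlaneField 𝓘(ℝ, E) E := fun q => (JetSpace.contactSystem (ν + 1) m (φ q)).comap
    (mfderiv 𝓘(ℝ, E) 𝓘(ℝ, JetSpace (ν + 1) m) φ q).toLinearMap
  have hF : IsPullback φ F (JetSpace.contactSystem (ν + 1) m) := fun _ _ => rfl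
  refine IsPullback.locallyEquivalentAt (fun q hq => ?_) hφ hpφ
  have hqW := hφW hq
  let S : Submodule ℝ E := F q
  have h1 : Module.finrank ℝ S = m + 1 := by
    refine (hφ.finrank_eq hF hq).trans ?_
    rw [JetSpace.contactSystem_eq]
    refine (JetSpace.finrank_contactFlag (Nat.zero_le (ν + 1)) (φ q)).trans ?_
    rw [zero_add, one_mul]
  -- The forms of orders 0 to ν all annihilate D, which is the case k = 0 of `contactForm_eq_zero`;
  -- equality of ranks then gives D = S.
  have h2 : D.flagAt 0 q ≤ S := by
    refine flagAt_le (fun U hqU hU Y hY => ?_) hqW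
    have h3 : fderiv ℝ Φ q (Y q) ∈ JetSpace.contactFlag (ν + 1) m 0 (Φ q) := by
      refine JetSpace.mem_contactFlag.2 fun l hl j => ?_
      rw [hdΦ q hqW]
      exact h.contactForm_eq_zero (l := l) (k := 0) (by omega) hU hY hqU j
    change mfderiv 𝓘(ℝ, E) 𝓘(ℝ, JetSpace (ν + 1) m) φ q (Y q) ∈
      JetSpace.contactSystem (ν + 1) m (φ q)
    rw [JetSpace.contactSystem_eq, mfderiv_eq_fderiv, hΦφ]
    exact h3
  have h3 : D.flagAt 0 q = S :=
    Submodule.eq_of_le_of_finrank_le h2 (by rw [h1, hrank 0 (by omega) q (hWV hqW)]; simp)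
  exact (flagAt_zero hD (hWV hqW)).symm.trans h3

end PlaneField

/-! ### Passage to charts and conclusion. -/

namespace PlaneField

section Comp

variable {E H : Type*} [NormedAddCommGroup E] [NormedSpace ℝ E] [TopologicalSpace H]
  {I : ModelWithCorners ℝ E H} {M : Type*} [TopologicalSpace M] [ChartedSpace H M]
  {E' H' : Type*} [NormedAddCommGroup E'] [NormedSpace ℝ E'] [TopologicalSpace H']
  {I' : ModelWithCorners ℝ E' H'} {M' : Type*} [TopologicalSpace M'] [ChartedSpace H' M']
  {E'' H'' : Type*} [NormedAddCommGroup E''] [NormedSpace ℝ E''] [TopologicalSpace H'']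
  {I'' : ModelWithCorners ℝ E'' H''} {M'' : Type*} [TopologicalSpace M''] [ChartedSpace H'' M'']

lemma IsLocalDiffeo.trans {φ : OpenPartialHomeomorph M M'} {ψ : OpenPartialHomeomorph M' M''}
    (hφ : IsLocalDiffeo I I' φ) (hψ : IsLocalDiffeo I' I'' ψ) :
    IsLocalDiffeo I I'' (φ.trans ψ) := by
  refine ⟨?_, ?_⟩
  · rw [φ.trans_source]
    exact hψ.smooth.comp (hφ.smooth.mono Set.inter_subset_left) fun q hq => hq.2
  · rw [φ.trans_target]
    exact hφ.smooth_symm.comp (hψ.smooth_symm.mono Set.inter_subset_left) fun q hq => hq.2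

lemma IsPullback.trans {φ : OpenPartialHomeomorph M M'} {ψ : OpenPartialHomeomorph M' M''}
    (hφ : IsLocalDiffeo I I' φ) (hψ : IsLocalDiffeo I' I'' ψ) {D : PlaneField I M}
    {D' : PlaneField I' M'} {D'' : PlaneField I'' M''} (h : IsPullback φ D D')
    (h' : IsPullback ψ D' D'') : IsPullback (φ.trans ψ) D D'' := by
  intro q hq
  rw [φ.trans_source] at hq
  have h1 : mfderiv I I'' (ψ ∘ φ) q = (mfderiv I' I'' ψ (φ q)).comp (mfderiv I I' φ q) :=
    mfderiv_comp q (hψ.mdifferentiable.mdifferentiableAt hq.2)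
      (hφ.mdifferentiable.mdifferentiableAt hq.1)
  rw [h q hq.1, h' _ hq.2]
  ext v
  change _ ↔ mfderiv I I'' (ψ ∘ φ) q v ∈ D'' (ψ (φ q))
  rw [h1]
  rfl

lemma LocallyEquivalentAt.of_isPullback {φ : OpenPartialHomeomorph M M'}
    (hφ : IsLocalDiffeo I I' φ) {D : PlaneField I M} {D' : PlaneField I' M'}
    {D'' : PlaneField I'' M''} (h : IsPullback φ D D') {p : M} (hp : p ∈ φ.source)
    (h' : D'.LocallyEquivalentAt D'' (φ p)) : D.LocallyEquivalentAt D'' p := by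
  obtain ⟨ψ, hpψ, hψ, h''⟩ := h'.exists_isPullback
  refine (h.trans hφ hψ h'').locallyEquivalentAt (hφ.trans hψ) ?_
  rw [φ.trans_source]
  exact ⟨hp, hpψ⟩

end Comp

section Chart

variable {E : Type} [NormedAddCommGroup E] [NormedSpace ℝ E] [FiniteDimensional ℝ E]
  {M : Type*} [TopologicalSpace M] [ChartedSpace E M] [IsManifold 𝓘(ℝ, E) ∞ M]

omit [FiniteDimensional ℝ E] in
lemma isLocalDiffeo_chartAt (p : M) : IsLocalDiffeo 𝓘(ℝ, E) 𝓘(ℝ, E) (chartAt E p) :=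
  ⟨contMDiffOn_chart, contMDiffOn_chart_symm⟩

lemma locallyEquivalentAt_contactSystem_of_flags {D : PlaneField 𝓘(ℝ, E) M} {ν m : ℕ}
    (hdim : Module.finrank ℝ E = (ν + 2) * m + 1) (hD : D.IsDistribution (m + 1))
    (hrank : ∀ i ≤ ν + 1, (D.derivedFlag i).HasConstantRank ((i + 1) * m + 1))
    (hlie : (D.lieFlag (ν + 1)).HasConstantRank ((ν + 1 + 1) * m + 1))
    (hinv : (D.derivedFlag ν).ContainsInvolutiveCorankOne) (p : M) :
    D.LocallyEquivalentAt (JetSpace.contactSystem (ν + 1) m) p := by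
  let φ := chartAt E p
  have hφ : IsLocalDiffeo 𝓘(ℝ, E) 𝓘(ℝ, E) φ := isLocalDiffeo_chartAt p
  let D' : PlaneField 𝓘(ℝ, E) E := fun q =>
    (D (φ.symm q)).comap (mfderiv 𝓘(ℝ, E) 𝓘(ℝ, E) φ.symm q).toLinearMap
  have hD' : IsPullback φ.symm D' D := fun _ _ => rfl
  have hp : p ∈ φ.source := mem_chart_source E p
  have hφp : φ p ∈ φ.symm.source := φ.map_source hp
  let V := IsLocalDiffeo.preimageOpens φ.symm ⊤
  -- The distribution is moved to the model space by a chart, and the flag conditions are carried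
  -- along by the invariance results. The image is controlled only on the chart's target, hence the
  -- open set V.
  refine LocallyEquivalentAt.of_isPullback hφ (hφ.symm.isPullback_symm hD') hp ?_
  refine locallyEquivalentAt_contactSystem (V := V) ⟨hφp, trivial⟩ hdim (hD.isPullback hφ.symm hD')
    (fun i hi q hq => ?_) ?_ ?_
  · exact (hφ.symm.finrank_eq (hφ.symm.isPullback_derivedFlag hD' i) hq.1).trans (hrank i hi _)
  · let S : Submodule ℝ E := D'.lieFlag (ν + 1) (φ p)
    refine Submodule.eq_top_of_finrank_eq (S := S) ?_
    rw [hdim]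
    exact (hφ.symm.finrank_eq (hφ.symm.isPullback_lieFlag hD' (ν + 1)) hφp).trans (hlie _)
  · exact ContainsInvolutiveCorankOneAt.isPullback hφ.symm
      (hφ.symm.isPullback_derivedFlag hD' ν) hφp (hinv _)

end Chart

end PlaneField

theorem theorem1 (n m : ℕ) (hn : 1 ≤ n)
    {M : Type*} [TopologicalSpace M]
    [ChartedSpace (EuclideanSpace ℝ (Fin ((n + 1) * m + 1))) M]
    [IsManifold (𝓡 ((n + 1) * m + 1)) ∞ M]
    (D : PlaneField (𝓡 ((n + 1) * m + 1)) M) (hD : D.IsDistribution (m + 1)) :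
    (∀ p : M, D.LocallyEquivalentAt (JetSpace.contactSystem n m) p) ↔
      ∀ i : ℕ, i ≤ n →
        ((D.derivedFlag i).HasConstantRank ((i + 1) * m + 1) ∧
          (D.derivedFlag i).ContainsInvolutiveCorankOne) ∧
        (D.lieFlag i).HasConstantRank ((i + 1) * m + 1) := by
  refine ⟨fun h i hi => PlaneField.flags_of_locallyEquivalentAt_contactSystem h hi,
    fun h p => ?_⟩
  -- ν = n - 1 is the level whose involutive subdistribution supplies the functions z and x_j.
  obtain ⟨ν, rfl⟩ : ∃ ν, n = ν + 1 := ⟨n - 1, by omega⟩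
  exact PlaneField.locallyEquivalentAt_contactSystem_of_flags finrank_euclideanSpace_fin hD
    (fun i hi => (h i hi).1.1) (h _ le_rfl).2 (h ν (Nat.le_succ ν)).1.2 p
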